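/- A groupoid $G$ is regarded as its set of arrows, with units $G^0\subseteq G$, source $\mathsf s(g)=g^{-1}g$ and range $\mathsf r(g)=gg^{-1}$. A \emph{bisection} is a subset of $G$ on which both $\mathsf s$ and $\mathsf r$ are injective. A Hausdorff groupoid $G$ is \emph{ample} if inversion is continuous, multiplication is continuous on the set of composable pairs, $\mathsf s$ is a local homeomorphism onto an open subset of $G$, and the compact open bisections form a basis of the topology. For $x\in G^0$ let \[H_x=\{g\in\mathrm{int}(G^{\mathrm{iso}}):\mathsf s(g)=x=\mathsf r(g)\},\qquad G^{\mathrm{iso}}=\{g\in G:\mathsf s(g)=\mathsf r(g)\},\] be the interior isotropy group at $x$. A unital ring is \emph{indecomposable} if it is nonzero and its only central idempotents are $0$ and $1$. For a unital ring $K$, the Steinberg algebra $A_K(G)$ is the set of locally constant compactly supported functions $a:G\to K$ with the convolution product $(ab)(g)=\sum_{hk=g}a(h)b(k)$, and its diagonal is $D_K(G)=\{a\in A_K(G):\mathrm{supp}(a)\subseteq G^0\}$. Let $G$ and $G'$ be ample Hausdorff groupoids and let $K$ and $K'$ be indecomposable unital rings, not necessarily commutative. Suppose that $(G,K)$ satisfies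 at least one of the following conditions, and that $(G',K')$ also satisfies at least one of them (not necessarily the same one): \begin{enumerate} \item $G$ is effective, i.e. $\mathrm{int}(G^{\mathrm{iso}})=G^0$; \item for each $x\in G^0$, the group $H_x$ is free, or torsion-free and abelian; \item for each $x\in G^0$, the group $H_x$ is left orderable or right orderable; \item for each $x\in G^0$, the group $H_x$ has the unique product property: for all nonempty finite $A,B\subseteq H_x$ some element of $AB$ can be written in exactly one way as $ab$ with $a\in A$ and $b\in B$; \item for each $x\in G^0$, the group ring $KH_x$ has no non-trivial units, i.e. each of its units has the form $kh$ with $k\in K^\times$ and $h\in H_x$; \item for each $x\in G^0$, each unit of $KH_x$, viewed as a function $H_x\to K$, is the restriction to $H_x$ of some $a\in A_K(G)$ whose support is a bisection. \end{enumerate} If there is a semigroup isomorphism $\phi:A_K(G)\to A_{K'}(G')$ (a bijection preserving the convolution product, not assumed additive) with $\phi[D_K(G)]=D_{K'}(G')$, then $G$ and $G'$ are isomorphic as étale groupoids, i.e. there is a homeomorphism $G\to G'$ that is an isomorphism of groupoids. -/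

import Mathlib

open Topology

universe u v

/-- A groupoid given by its set of arrows `G`, identifying units with the identity arrows. The pair
`(g, h)` is composable when `src g = rng h`. The product `mul g h` is only meaningful for
composable pairs: no law mentions it for other pairs. -/
class ArrowGroupoid (G : Type u) where
  src : G → G
  rng : G → G
  inv : G → G
  mul : G → G → G
  src_mul : ∀ g h, src g = rng h → src (mul g h) = src h
  rng_mul : ∀ g h, src g = rng h → rng (mul g h) = rng g
  mul_assoc : ∀ g h k, src g = rng h → src h = rng k → mul (mul g h) k = mul g (mul h k)
  mul_src : ∀ g, mul g (src g) = g
  rng_mul_self : ∀ g, mul (rng g) g = g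
  src_inv : ∀ g, src (inv g) = rng g
  rng_inv : ∀ g, rng (inv g) = src g
  inv_mul : ∀ g, mul (inv g) g = src g
  mul_inv : ∀ g, mul g (inv g) = rng g

namespace ArrowGroupoid

section Algebra

variable {G : Type u} [ArrowGroupoid G]

theorem src_src (g : G) : src (src g) = src g := by
  rw [← inv_mul g, src_mul _ _ (src_inv g), inv_mul]

theorem rng_src (g : G) : rng (src g) = src g := by
  rw [← inv_mul g, rng_mul _ _ (src_inv g), inv_mul, rng_inv]

theorem src_rng (g : G) : src (rng g) = rng g := by
  rw [← mul_inv g, src_mul _ _ (rng_inv g).symm, src_inv, mul_inv]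

theorem rng_rng (g : G) : rng (rng g) = rng g := by
  rw [← mul_inv g, rng_mul _ _ (rng_inv g).symm, mul_inv]

variable (G)

/-- The unit space `G⁰`, as a set of arrows. -/
def units : Set G := Set.range (src : G → G)

/-- The isotropy `{g : s(g) = r(g)}`. -/
def iso : Set G := {g | src g = rng g}

variable {G}

/-- A bisection: a set of arrows on which both the source and the range are injective. -/
def IsBisection (B : Set G) : Prop :=
  Set.InjOn (src : G → G) B ∧ Set.InjOn (rng : G → G) B

theorem units_subset_iso : units G ⊆ iso G := by
  rintro _ ⟨g, rfl⟩
  show src (src g) = rng (src g)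
  rw [src_src, rng_src]

theorem src_eq_self_of_mem_units {x : G} (hx : x ∈ units G) : src x = x := by
  obtain ⟨g, rfl⟩ := hx
  exact src_src g

theorem rng_eq_self_of_mem_units {x : G} (hx : x ∈ units G) : rng x = x := by
  obtain ⟨g, rfl⟩ := hx
  exact rng_src g

theorem inv_inv (g : G) : inv (inv g) = g := by
  have h1 : mul (mul (inv (inv g)) (inv g)) g = mul (inv (inv g)) (mul (inv g) g) :=
    mul_assoc _ _ _ (src_inv _) (src_inv _)
  rw [inv_mul, inv_mul, src_inv, rng_mul_self] at h1
  have h2 := mul_src (inv (inv g))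
  rw [src_inv, rng_inv] at h2
  exact h2.symm.trans h1.symm

theorem src_comp_inv : (src : G → G) ∘ inv = rng := funext src_inv

theorem mul_inv_mul {k h : G} (e : src k = src h) : mul (mul k (inv h)) h = k := by
  rw [mul_assoc _ _ _ (by rw [rng_inv, e]) (src_inv h), inv_mul, ← e, mul_src]

theorem mul_mul_inv {g h : G} (e : src g = rng h) : mul (mul g h) (inv h) = g := by
  rw [mul_assoc _ _ _ e (rng_inv h).symm, mul_inv, ← e, mul_src]

theorem mul_inv_mul_self {g h : G} (e : rng h = rng g) : mul h (mul (inv h) g) = g := by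
  rw [← mul_assoc _ _ _ (rng_inv h).symm ((src_inv h).trans e), mul_inv, e, rng_mul_self]

end Algebra

/-- An étale groupoid: inversion is continuous, multiplication is continuous on the set of
composable pairs, and the source map is a local homeomorphism onto an open subset of `G`
(equivalently, a local homeomorphism as a map from `G` to `G`). -/
class IsEtale (G : Type u) [TopologicalSpace G] [ArrowGroupoid G] : Prop where
  continuous_inv : Continuous (inv : G → G)
  continuousOn_mul :
    ContinuousOn (fun p : G × G => mul p.1 p.2) {p : G × G | src p.1 = rng p.2}
  isLocalHomeomorph_src : IsLocalHomeomorph (src : G → G)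

/-- An ample groupoid (with Hausdorff unit space): an étale groupoid with a basis of compact
open bisections. -/
class IsAmple (G : Type u) [TopologicalSpace G] [ArrowGroupoid G] : Prop extends IsEtale G where
  isTopologicalBasis :
    TopologicalSpace.IsTopologicalBasis {B : Set G | IsOpen B ∧ IsCompact B ∧ IsBisection B}

section Topological

variable {G : Type u} [TopologicalSpace G] [ArrowGroupoid G]

variable (G) in
/-- A groupoid is effective when the interior of the isotropy is the unit space. -/
def IsEffective : Prop := interior (iso G) = units G

/-- The interior isotropy group `H_x = {g ∈ int(iso G) : s(g) = x = r(g)}` at a unit `x`. -/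
@[ext]
structure IntIsotropy (x : units G) : Type u where
  val : G
  mem_interior : val ∈ interior (iso G)
  src_eq : src val = x
  rng_eq : rng val = x

theorem IntIsotropy.composable {x : units G} (g h : IntIsotropy x) : src g.val = rng h.val :=
  g.src_eq.trans h.rng_eq.symm

variable [IsEtale G]

theorem continuous_src : Continuous (src : G → G) :=
  IsEtale.isLocalHomeomorph_src.continuous

theorem isLocalHomeomorph_rng : IsLocalHomeomorph (rng : G → G) := by
  rw [← src_comp_inv]
  refine IsEtale.isLocalHomeomorph_src.comp ?_
  exact (Homeomorph.mk ⟨inv, inv, inv_inv, inv_inv⟩ IsEtale.continuous_inv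
    IsEtale.continuous_inv).isLocalHomeomorph

theorem continuous_rng : Continuous (rng : G → G) := isLocalHomeomorph_rng.continuous

theorem isOpen_units : IsOpen (units G) :=
  IsEtale.isLocalHomeomorph_src.isOpenMap.isOpen_range

theorem mem_interior_iso_of_mem_units {x : G} (hx : x ∈ units G) : x ∈ interior (iso G) :=
  interior_maximal units_subset_iso isOpen_units hx

theorem inv_mem_interior_iso {g : G} (hg : g ∈ interior (iso G)) :
    inv g ∈ interior (iso G) := by
  rw [mem_interior]
  refine ⟨inv ⁻¹' interior (iso G), ?_, isOpen_interior.preimage IsEtale.continuous_inv, ?_⟩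
  · intro k hk
    have := interior_subset hk
    have h' : src (inv k) = rng (inv k) := this
    rw [src_inv, rng_inv] at h'
    exact h'.symm
  · simpa [inv_inv] using hg

theorem tendsto_mul {α : Type v} {l : Filter α} {p q : α → G} {g h : G}
    (hp : Filter.Tendsto p l (𝓝 g)) (hq : Filter.Tendsto q l (𝓝 h)) (hgh : src g = rng h)
    (hpq : ∀ᶠ t in l, src (p t) = rng (q t)) :
    Filter.Tendsto (fun t => mul (p t) (q t)) l (𝓝 (mul g h)) := by
  have h1 := IsEtale.continuousOn_mul (G := G) (g, h) hgh
  exact Filter.Tendsto.comp h1 (tendsto_nhdsWithin_iff.2 ⟨hp.prodMk_nhds hq, hpq⟩)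

theorem mul_mem_interior_iso {g h : G} (hg : g ∈ interior (iso G)) (hh : h ∈ interior (iso G))
    (e : src g = rng h) : mul g h ∈ interior (iso G) := by
  obtain ⟨f, hf, hfe⟩ := IsEtale.isLocalHomeomorph_src (G := G) h
  have hfs : ∀ k, f k = src k := fun k => congrFun hfe.symm k
  have hs : Filter.Tendsto (src : G → G) (𝓝 (mul g h)) (𝓝 (f h)) := by
    have := (continuous_src (G := G)).tendsto (mul g h)
    rwa [src_mul _ _ e, ← hfs h] at this
  have htgt : f h ∈ f.target := f.map_source hf
  have hσ : Filter.Tendsto (fun k : G => f.symm (src k)) (𝓝 (mul g h)) (𝓝 h) :=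
    (f.tendsto_symm hf).comp hs
  have hmem : ∀ᶠ k in 𝓝 (mul g h), src (f.symm (src k)) = src k := by
    filter_upwards [hs (f.open_target.mem_nhds htgt)] with k hk
    rw [← hfs, f.right_inv hk]
  have hσi : Filter.Tendsto (fun k : G => inv (f.symm (src k))) (𝓝 (mul g h)) (𝓝 (inv h)) :=
    (IsEtale.continuous_inv.tendsto h).comp hσ
  have hq := tendsto_mul (Filter.tendsto_id (α := G)) hσi
    (by rw [src_mul _ _ e, rng_inv]) (by
      filter_upwards [hmem] with k hk
      rw [rng_inv, hk]; rfl)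
  rw [mul_mul_inv e] at hq
  rw [mem_interior_iff_mem_nhds]
  filter_upwards [hmem, hσ (isOpen_interior.mem_nhds hh), hq (isOpen_interior.mem_nhds hg)]
    with k h1 h2 h3
  have h2' : src (f.symm (src k)) = rng (f.symm (src k)) :=
    interior_subset (s := iso G) h2
  have h3' : src (mul k (inv (f.symm (src k)))) = rng (mul k (inv (f.symm (src k)))) :=
    interior_subset (s := iso G) h3
  have e1 : src k = rng (inv (f.symm (src k))) := by rw [rng_inv, h1]
  rw [src_mul _ _ e1, rng_mul _ _ e1, src_inv, ← h2', h1] at h3'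
  exact h3'

/-- The group structure of `H_x` is the restriction of the product and the inverse of `G`. -/
instance (x : units G) : Group (IntIsotropy x) where
  mul g h := ⟨mul g.val h.val,
    mul_mem_interior_iso g.mem_interior h.mem_interior (g.composable h),
    (src_mul _ _ (g.composable h)).trans h.src_eq,
    (rng_mul _ _ (g.composable h)).trans g.rng_eq⟩
  one := ⟨x.1, mem_interior_iso_of_mem_units x.2, src_eq_self_of_mem_units x.2,
    rng_eq_self_of_mem_units x.2⟩
  inv g := ⟨inv g.val, inv_mem_interior_iso g.mem_interior, (src_inv _).trans g.rng_eq,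
    (rng_inv _).trans g.src_eq⟩
  mul_assoc g h k :=
    IntIsotropy.ext (mul_assoc _ _ _ (g.composable h) (h.composable k))
  one_mul g := IntIsotropy.ext (by
    show mul x.1 g.val = g.val
    rw [← g.rng_eq, rng_mul_self])
  mul_one g := IntIsotropy.ext (by
    show mul g.val x.1 = g.val
    rw [← g.src_eq, mul_src])
  inv_mul_cancel g := IntIsotropy.ext (by
    show mul (inv g.val) g.val = x.1
    rw [inv_mul, g.src_eq])

end Topological

section Convolution

variable {G : Type u} [ArrowGroupoid G] {K : Type v} [Ring K]

/-- The convolution product `(ab)(g) = ∑ a(h) b(k)` over all composable `(h, k)` with `hk = g`.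
These are exactly the pairs `(h, h⁻¹g)` with `r(h) = r(g)`. -/
noncomputable def conv (a b : G → K) (g : G) : K :=
  ∑ᶠ (h : G) (_ : rng h = rng g), a h * b (mul (inv h) g)

variable [TopologicalSpace G] [IsEtale G] [T2Space G]

theorem hasCompactSupport_conv {a b : G → K} (ha : HasCompactSupport a)
    (hb : HasCompactSupport b) : HasCompactSupport (conv a b) := by
  classical
  have hcl : IsClosed {p : G × G | src p.1 = rng p.2} :=
    isClosed_eq (continuous_src.comp continuous_fst) (continuous_rng.comp continuous_snd)
  have hc : IsCompact ((tsupport a ×ˢ tsupport b) ∩ {p : G × G | src p.1 = rng p.2}) :=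
    (ha.isCompact.prod hb.isCompact).inter_right hcl
  have hi := hc.image_of_continuousOn (IsEtale.continuousOn_mul.mono Set.inter_subset_right)
  refine HasCompactSupport.intro hi ?_
  intro g hg
  unfold conv
  refine finsum_eq_zero_of_forall_eq_zero fun h => ?_
  by_cases e : rng h = rng g
  swap
  · rw [finsum_eq_if, if_neg e]
  rw [finsum_eq_if, if_pos e]
  by_contra hne
  apply hg
  refine ⟨(h, mul (inv h) g), ⟨⟨subset_tsupport _ ?_, subset_tsupport _ ?_⟩, ?_⟩,
    mul_inv_mul_self e⟩
  · exact left_ne_zero_of_mul hne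
  · exact right_ne_zero_of_mul hne
  · show src h = rng (mul (inv h) g)
    rw [rng_mul _ _ ((src_inv h).trans e), rng_inv]

theorem isLocallyConstant_conv {a b : G → K} (ha : IsLocallyConstant a)
    (ha' : HasCompactSupport a) (hb : IsLocallyConstant b) : IsLocallyConstant (conv a b) := by
  classical
  rw [IsLocallyConstant.iff_eventually_eq]
  intro g₀
  have hsc : IsCompact (Function.support a) := by
    have hcl : IsClosed (Function.support a) := by
      rw [← isOpen_compl_iff]
      have : (Function.support a)ᶜ = a ⁻¹' {0} := by ext; simp
      rw [this]
      exact ha _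
    have := ha'.isCompact
    rwa [tsupport, hcl.closure_eq] at this
  choose e he hee using isLocalHomeomorph_rng (G := G)
  have hef : ∀ h k, e h k = rng k := fun h k => congrFun (hee h).symm k
  -- the fibre of the range map in the support of `a` is finite
  have hfin : (Function.support a ∩ {h | rng h = rng g₀}).Finite := by
    obtain ⟨t, ht⟩ := hsc.elim_finite_subcover (fun h => (e h).source)
      (fun h => (e h).open_source) (fun h _ => Set.mem_iUnion.2 ⟨h, he h⟩)
    refine (t.finite_toSet.biUnion (t := fun i => (e i).source ∩ {h | rng h = rng g₀})
      fun i _ => ?_).subset ?_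
    · refine Set.Subsingleton.finite ?_
      rintro x ⟨hx, hx'⟩ y ⟨hy, hy'⟩
      apply (e i).injOn hx hy
      rw [hef, hef]
      exact hx'.trans hy'.symm
    · rintro x ⟨hx, hx'⟩
      obtain ⟨i, hi, hi'⟩ := Set.mem_iUnion₂.1 (ht hx)
      exact Set.mem_iUnion₂.2 ⟨i, hi, hi', hx'⟩
  obtain ⟨U, hU, hdisj⟩ := hfin.t2_separation
  set F : Finset G := hfin.toFinset with hF
  have hFm : ∀ h, h ∈ F ↔ a h ≠ 0 ∧ rng h = rng g₀ := by
    intro h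
    simp [hF]
  let W : G → Set G := fun h => U h ∩ (e h).source ∩ {k | a k = a h}
  have hWo : ∀ h, IsOpen (W h) := fun h =>
    ((hU h).2.inter (e h).open_source).inter (ha {c | c = a h})
  have hWm : ∀ h, h ∈ W h := fun h => ⟨⟨(hU h).1, he h⟩, rfl⟩
  have hC : IsCompact (Function.support a \ ⋃ h ∈ F, W h) :=
    hsc.diff (isOpen_biUnion fun h _ => hWo h)
  have hCc : IsClosed (rng '' (Function.support a \ ⋃ h ∈ F, W h)) :=
    (hC.image continuous_rng).isClosed
  have hr₀ : rng g₀ ∉ rng '' (Function.support a \ ⋃ h ∈ F, W h) := by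
    rintro ⟨h, ⟨h1, h2⟩, h3⟩
    exact h2 (Set.mem_iUnion₂.2 ⟨h, (hFm h).2 ⟨h1, h3⟩, hWm h⟩)
  have ev1 : ∀ᶠ g in 𝓝 g₀, rng g ∉ rng '' (Function.support a \ ⋃ h ∈ F, W h) :=
    continuous_rng.continuousAt (hCc.isOpen_compl.mem_nhds hr₀)
  have hσ : ∀ h ∈ F, Filter.Tendsto (fun g => (e h).symm (rng g)) (𝓝 g₀) (𝓝 h) := by
    intro h hh
    refine ((e h).tendsto_symm (he h)).comp ?_
    rw [hef, ((hFm h).1 hh).2]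
    exact continuous_rng.tendsto g₀
  have ev2 : ∀ᶠ g in 𝓝 g₀, ∀ h ∈ F, rng ((e h).symm (rng g)) = rng g := by
    rw [Filter.eventually_all_finset]
    intro h hh
    have : rng g₀ ∈ (e h).target := by
      rw [← ((hFm h).1 hh).2, ← hef h]
      exact (e h).map_source (he h)
    filter_upwards [continuous_rng.continuousAt ((e h).open_target.mem_nhds this)] with g hg
    rw [← hef h, (e h).right_inv hg]
  have ev3 : ∀ᶠ g in 𝓝 g₀, ∀ h ∈ F, (e h).symm (rng g) ∈ W h := by
    rw [Filter.eventually_all_finset]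
    intro h hh
    exact hσ h hh ((hWo h).mem_nhds (hWm h))
  have ev4 : ∀ᶠ g in 𝓝 g₀, ∀ h ∈ F,
      b (mul (inv ((e h).symm (rng g))) g) = b (mul (inv h) g₀) := by
    rw [Filter.eventually_all_finset]
    intro h hh
    have ht := tendsto_mul ((IsEtale.continuous_inv.tendsto h).comp (hσ h hh))
      Filter.tendsto_id ((src_inv h).trans ((hFm h).1 hh).2) (by
        filter_upwards [ev2] with g hg
        exact (src_inv _).trans (hg h hh))
    exact ht ((IsLocallyConstant.iff_eventually_eq b).1 hb _)
  have key : ∀ᶠ g in 𝓝 g₀, conv a b g = ∑ h ∈ F, a h * b (mul (inv h) g₀) := by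
    filter_upwards [ev1, ev2, ev3, ev4] with g h1 h2 h3 h4
    have hinj : Set.InjOn (fun h => (e h).symm (rng g)) (F : Set G) := by
      intro h hh k hk hhk
      by_contra hne
      have hd := hdisj (by simpa [hF] using hh) (by simpa [hF] using hk) hne
      refine Set.disjoint_left.1 hd (h3 h hh).1.1 ?_
      have := (h3 k hk).1.1
      simp only at hhk
      rwa [← hhk] at this
    have hsupp : Function.support
        (fun h : G => ∑ᶠ (_ : rng h = rng g), a h * b (mul (inv h) g)) ⊆
        (F.image fun h => (e h).symm (rng g) : Finset G) := by
      intro k hk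
      rw [Function.mem_support] at hk
      by_cases hkr : rng k = rng g
      · rw [finsum_eq_if, if_pos hkr] at hk
        have hak : a k ≠ 0 := left_ne_zero_of_mul hk
        have hkW : k ∈ ⋃ h ∈ F, W h := by
          by_contra hkn
          exact h1 ⟨k, ⟨hak, hkn⟩, hkr⟩
        obtain ⟨h, hh, hkh⟩ := Set.mem_iUnion₂.1 hkW
        rw [Finset.coe_image]
        refine ⟨h, hh, ?_⟩
        show (e h).symm (rng g) = k
        rw [← hkr, ← hef h, (e h).left_inv hkh.1.2]
      · rw [finsum_eq_if, if_neg hkr] at hk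
        exact absurd rfl hk
    unfold conv
    rw [finsum_eq_sum_of_support_subset _ hsupp, Finset.sum_image hinj]
    refine Finset.sum_congr rfl fun h hh => ?_
    rw [finsum_eq_if, if_pos (h2 h hh), h4 h hh]
    congr 1
    exact (h3 h hh).2
  have k0 := key.self_of_nhds
  filter_upwards [key] with g hg
  rw [hg, k0]

end Convolution

/-- The Steinberg algebra `A_K(G)` of a Hausdorff ample groupoid: the locally constant compactly
supported functions from `G` to `K`. Only its multiplicative structure is used. -/
@[ext]
structure SteinbergAlgebra (K : Type v) [Ring K] (G : Type u) [TopologicalSpace G] :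
    Type (max u v) where
  toFun : G → K
  isLocallyConstant : IsLocallyConstant toFun
  hasCompactSupport : HasCompactSupport toFun

section Steinberg

variable (K : Type v) [Ring K] (G : Type u) [TopologicalSpace G] [ArrowGroupoid G]

/-- The Steinberg algebra is multiplied by convolution. -/
noncomputable instance [IsAmple G] [T2Space G] : Mul (SteinbergAlgebra K G) where
  mul a b := ⟨conv a.toFun b.toFun,
    isLocallyConstant_conv a.isLocallyConstant a.hasCompactSupport b.isLocallyConstant,
    hasCompactSupport_conv a.hasCompactSupport b.hasCompactSupport⟩

/-- The diagonal of the Steinberg algebra: the functions supported on the unit space. -/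
def diagonal : Set (SteinbergAlgebra K G) := {a | Function.support a.toFun ⊆ units G}

/-- Any one of the following: `G` is effective; each `H_x` is free, or torsion-free and abelian;
each `H_x` is left or right orderable; each `H_x` has the unique product property; each group
ring `K[H_x]` has only trivial units; each unit of `K[H_x]` is the restriction to `H_x` of an
element of `A_K(G)` whose support is a bisection. -/
def IsotropyCondition [IsEtale G] : Prop :=
  IsEffective G ∨
  (∀ x : units G, IsFreeGroup (IntIsotropy x) ∨
    ((∀ g : IntIsotropy x, IsOfFinOrder g → g = 1) ∧
      ∀ g h : IntIsotropy x, g * h = h * g)) ∨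
  (∀ x : units G, (∃ _ : LinearOrder (IntIsotropy x),
      ∀ g h k : IntIsotropy x, h ≤ k → g * h ≤ g * k) ∨
    (∃ _ : LinearOrder (IntIsotropy x),
      ∀ g h k : IntIsotropy x, h ≤ k → h * g ≤ k * g)) ∨
  (∀ x : units G, UniqueProds (IntIsotropy x)) ∨
  (∀ (x : units G) (c : (MonoidAlgebra K (IntIsotropy x))ˣ),
    ∃ (k : Kˣ) (h : IntIsotropy x), c.1 = MonoidAlgebra.single h (k : K)) ∨
  (∀ (x : units G) (c : (MonoidAlgebra K (IntIsotropy x))ˣ),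
    ∃ a : SteinbergAlgebra K G, IsBisection (Function.support a.toFun) ∧
      ∀ h : IntIsotropy x, a.toFun h.val = c.1.coeff h)

end Steinberg

/-- An isomorphism of étale groupoids: a homeomorphism that is an isomorphism of groupoids. -/
structure TopIso (G : Type u) (G' : Type v) [TopologicalSpace G] [TopologicalSpace G']
    [ArrowGroupoid G] [ArrowGroupoid G'] extends G ≃ₜ G' where
  map_src : ∀ g : G, toFun (src g) = src (toFun g)
  map_rng : ∀ g : G, toFun (rng g) = rng (toFun g)
  map_mul : ∀ g h : G, src g = rng h → toFun (mul g h) = mul (toFun g) (toFun h)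

end ArrowGroupoid

/-- A unital ring is indecomposable when it is nontrivial and its only central idempotents are
`0` and `1`. -/
def IsIndecomposableRing (K : Type u) [Ring K] : Prop :=
  Nontrivial K ∧ ∀ e : K, e * e = e → (∀ y : K, y * e = e * y) → e = 0 ∨ e = 1

/-! The groupoid is recovered from the normalizers of the diagonal: elements `n` with a partial
inverse `n'` such that `n n'` and `n' n` are diagonal idempotents commuting with the diagonal, and
conjugation by `n` and `n'` preserves the diagonal. This notion uses only products and the diagonal,
so `φ` transports it.

To a normalizer one attaches the set `unitSupport n` of arrows where its value is a unit of `K`.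
Indecomposability makes the idempotents involved 0/1-valued (`IsDiagIdem.apply`), and separating
units by such idempotents shows that the part of the support of `n` over one source is contained in
a single coset `g H_x`. Restricted to that coset, `n` becomes a unit of `K H_x` normalising the
coefficients `K`. Each isotropy condition makes such a unit monomial up to nilpotents: one value is
a unit and the others are multiples of it by nilpotent central elements
(`IsotropyCondition.hasMonomialUnits`). For unique product groups this is
`MonoidAlgebra.isMonomialModNil_of_uniqueProds`, proved modulo each prime of the centre of `K`. Free
groups, torsion-free abelian groups and one-sided orderable groups all have unique products.

Hence unit supports are compact open bisections. Every compact open bisection occurs, through its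
indicator function, and the unit support of a product is the product of the unit supports
(`mem_unitSupport_mul`). Disjointness of two unit supports is also multiplicative:
`not_disjoint_iff` expresses its failure as the existence of a common nonzero multiple `n c = m d`
with `c`, `d` diagonal. So `φ` respects products and disjointness of compact open bisections, and an
argument in the style of Stone duality (`IsBisectionBasis.nonempty_topIso`) rebuilds the arrows, the
topology and the multiplication. -/

/-! ### Groups with unique products -/

/-- Locally indicable groups have unique products. After translating `A` and `B` to contain 1, a
nontrivial map to `ℤ` from the subgroup they generate has top level sets in both; a unique product
of these smaller sets stays unique, because no other pair attains the maximal degree. -/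
theorem uniqueProds_of_exists_hom_ne_one {H : Type*} [Group H]
    (hH : ∀ L : Subgroup H, L.FG → L ≠ ⊥ → ∃ f : L →* Multiplicative ℤ, f ≠ 1) :
    UniqueProds H where
  uniqueMul_of_nonempty {A B} hA hB := by
    classical
    induction hn : A.card + B.card using Nat.strong_induction_on generalizing A B with
    | _ n ih =>
    obtain ⟨a₀, ha₀⟩ := hA
    obtain ⟨b₀, hb₀⟩ := hB
    set T : Finset H := A.image (fun a => a₀⁻¹ * a) ∪ B.image (fun b => b * b₀⁻¹) with hT
    have hTA : ∀ a ∈ A, a₀⁻¹ * a ∈ T := fun a ha =>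
      Finset.mem_union_left _ (Finset.mem_image_of_mem _ ha)
    have hTB : ∀ b ∈ B, b * b₀⁻¹ ∈ T := fun b hb =>
      Finset.mem_union_right _ (Finset.mem_image_of_mem (fun b => b * b₀⁻¹) hb)
    by_cases hL : Subgroup.closure (T : Set H) = ⊥
    · rw [Subgroup.closure_eq_bot_iff] at hL
      have hA' : ∀ a ∈ A, a = a₀ := fun a ha => by
        have := hL (hTA a ha)
        rw [Set.mem_singleton_iff, inv_mul_eq_one] at this
        exact this.symm
      have hB' : ∀ b ∈ B, b = b₀ := fun b hb => by
        have := hL (hTB b hb)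
        rwa [Set.mem_singleton_iff, mul_inv_eq_one] at this
      exact ⟨a₀, ha₀, b₀, hb₀, fun a b ha hb _ => ⟨hA' a ha, hB' b hb⟩⟩
    · obtain ⟨f, hf⟩ := hH _ ⟨T, rfl⟩ hL
      let F : H → ℤ := fun h =>
        if hh : h ∈ Subgroup.closure (T : Set H) then Multiplicative.toAdd (f ⟨h, hh⟩) else 0
      have hFmul : ∀ x ∈ T, ∀ y ∈ T, F (x * y) = F x + F y := by
        intro x hx y hy
        have hx2 : x ∈ Subgroup.closure (T : Set H) := Subgroup.subset_closure hx
        have hy2 : y ∈ Subgroup.closure (T : Set H) := Subgroup.subset_closure hy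
        simp only [F, dif_pos hx2, dif_pos hy2, dif_pos (mul_mem hx2 hy2)]
        rw [← toAdd_mul, ← map_mul]
        rfl
      have hF1 : F 1 = 0 := by
        simp only [F, dif_pos (one_mem (Subgroup.closure (T : Set H)))]
        exact congrArg Multiplicative.toAdd (map_one f)
      obtain ⟨aM, haM, hmA⟩ := A.exists_max_image (fun a => F (a₀⁻¹ * a)) ⟨a₀, ha₀⟩
      obtain ⟨bM, hbM, hmB⟩ := B.exists_max_image (fun b => F (b * b₀⁻¹)) ⟨b₀, hb₀⟩
      set A₁ := A.filter (fun a => F (a₀⁻¹ * a) = F (a₀⁻¹ * aM)) with hA₁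
      set B₁ := B.filter (fun b => F (b * b₀⁻¹) = F (bM * b₀⁻¹)) with hB₁
      -- If nothing were discarded, the degree would be constant on both translated sets. It is 0 at
      -- `a₀` and `b₀`, so `f` would vanish on the generators.
      have hlt : A₁.card + B₁.card < n := by
        by_contra hge
        have h1 : A₁.card ≤ A.card := Finset.card_filter_le _ _
        have h2 : B₁.card ≤ B.card := Finset.card_filter_le _ _
        have e1 : A₁ = A := Finset.eq_of_subset_of_card_le (Finset.filter_subset _ _) (by omega)
        have e2 : B₁ = B := Finset.eq_of_subset_of_card_le (Finset.filter_subset _ _) (by omega)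
        have z1 : ∀ a ∈ A, F (a₀⁻¹ * a) = 0 := by
          intro a ha
          rw [← e1, Finset.mem_filter] at ha
          rw [← e1, Finset.mem_filter, inv_mul_cancel, hF1] at ha₀
          rw [ha.2, ← ha₀.2]
        have z2 : ∀ b ∈ B, F (b * b₀⁻¹) = 0 := by
          intro b hb
          rw [← e2, Finset.mem_filter] at hb
          rw [← e2, Finset.mem_filter, mul_inv_cancel, hF1] at hb₀
          rw [hb.2, ← hb₀.2]
        apply hf
        refine MonoidHom.eq_of_eqOn_dense (s := ((↑) : Subgroup.closure (T : Set H) → H) ⁻¹' T)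
          (Subgroup.closure_closure_coe_preimage) ?_
        rintro ⟨x, hx⟩ hxT
        have hxF : F x = 0 := by
          have hxT' : x ∈ T := hxT
          rw [hT, Finset.mem_union, Finset.mem_image, Finset.mem_image] at hxT'
          obtain ⟨a, ha, rfl⟩ | ⟨b, hb, rfl⟩ := hxT'
          · exact z1 a ha
          · exact z2 b hb
        simp only [F, dif_pos hx] at hxF
        exact hxF
      obtain ⟨a, ha, b, hb, hu⟩ := ih _ hlt (A := A₁) (B := B₁)
        ⟨aM, Finset.mem_filter.2 ⟨haM, rfl⟩⟩ ⟨bM, Finset.mem_filter.2 ⟨hbM, rfl⟩⟩ rfl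
      obtain ⟨ha1, ha2⟩ := Finset.mem_filter.1 ha
      obtain ⟨hb1, hb2⟩ := Finset.mem_filter.1 hb
      refine ⟨a, ha1, b, hb1, fun a' b' ha' hb' he => ?_⟩
      have hs : F (a₀⁻¹ * a') + F (b' * b₀⁻¹) = F (a₀⁻¹ * a) + F (b * b₀⁻¹) := by
        rw [← hFmul _ (hTA _ ha') _ (hTB _ hb'), ← hFmul _ (hTA _ ha1) _ (hTB _ hb1)]
        congr 1
        rw [mul_assoc, ← mul_assoc a', he]
        group
      have := hmA _ ha'
      have := hmB _ hb'
      exact hu (Finset.mem_filter.2 ⟨ha', by omega⟩) (Finset.mem_filter.2 ⟨hb', by omega⟩) he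

theorem IsFreeGroup.exists_hom_ne_one (L : Type u) [Group L] [IsFreeGroup L] [Nontrivial L] :
    ∃ f : L →* Multiplicative ℤ, f ≠ 1 := by
  have hne : Nonempty (IsFreeGroup.Generators L) := by
    by_contra h
    rw [not_nonempty_iff] at h
    have : Subsingleton L := (IsFreeGroup.mulEquiv L).symm.toEquiv.subsingleton
    exact not_subsingleton L this
  obtain ⟨a⟩ := hne
  refine ⟨IsFreeGroup.lift fun _ => Multiplicative.ofAdd 1, fun h => ?_⟩
  have := DFunLike.congr_fun h (IsFreeGroup.of a)
  rw [IsFreeGroup.lift_of] at this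
  exact absurd (congrArg Multiplicative.toAdd this) one_ne_zero

/-- By Nielsen–Schreier every subgroup is free, and a nontrivial free group maps nontrivially to
`ℤ`. -/
theorem IsFreeGroup.uniqueProds (H : Type u) [Group H] [IsFreeGroup H] : UniqueProds H :=
  uniqueProds_of_exists_hom_ne_one fun L _ hL =>
    have := (Subgroup.nontrivial_iff_ne_bot L).2 hL
    IsFreeGroup.exists_hom_ne_one L

/-- A finitely generated torsion-free abelian group is free over `ℤ`, so its dual separates points.
-/
theorem uniqueProds_of_comm_of_torsionFree {H : Type u} [Group H]
    (hc : ∀ g h : H, g * h = h * g) (ht : ∀ g : H, IsOfFinOrder g → g = 1) : UniqueProds H := by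
  refine uniqueProds_of_exists_hom_ne_one fun L hL hne => ?_
  let _ : CommGroup L := { (inferInstance : Group L) with
    mul_comm := fun a b => Subtype.ext (hc a b) }
  have hfg : Group.FG L := (Group.fg_iff_subgroup_fg L).2 hL
  have : Module.Finite ℤ (Additive L) := Module.Finite.iff_addGroup_fg.2 inferInstance
  have htf : IsMulTorsionFree L := by
    rw [isMulTorsionFree_iff_not_isOfFinOrder]
    intro a ha hf
    apply ha
    exact Subtype.ext (ht _ ((Submonoid.isOfFinOrder_coe (H := L.toSubmonoid) (x := a)).2 hf))
  have : Module.IsTorsionFree ℤ (Additive L) := inferInstance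
  have : Module.Free ℤ (Additive L) := Module.free_of_finite_type_torsion_free'
  obtain ⟨x, hx⟩ := Subgroup.ne_bot_iff_exists_ne_one.1 hne
  have hx' : Additive.ofMul x ≠ 0 := hx
  obtain ⟨f, hf⟩ : ∃ f : Module.Dual ℤ (Additive L), f (Additive.ofMul x) ≠ 0 := by
    by_contra h
    push Not at h
    exact hx' ((Module.forall_dual_apply_eq_zero_iff ℤ _).1 h)
  refine ⟨AddMonoidHom.toMultiplicativeRight f.toAddMonoidHom, fun h => hf ?_⟩
  exact congrArg Multiplicative.toAdd (DFunLike.congr_fun h x)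

theorem uniqueProds_of_mul_le_mul_left {H : Type*} [Group H] [LinearOrder H]
    (h : ∀ a b c : H, b ≤ c → a * b ≤ a * c) : UniqueProds H := by
  have : MulLeftStrictMono H := ⟨fun a b c hbc =>
    lt_of_le_of_ne (h a b c hbc.le) fun e => hbc.ne (mul_left_cancel e)⟩
  infer_instance

theorem uniqueProds_of_mul_le_mul_right {H : Type*} [Group H] [LinearOrder H]
    (h : ∀ a b c : H, b ≤ c → b * a ≤ c * a) : UniqueProds H := by
  have : MulRightStrictMono H := ⟨fun a b c hbc =>
    lt_of_le_of_ne (h a b c hbc.le) fun e => hbc.ne (mul_right_cancel e)⟩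
  infer_instance

/-! ### Units of group rings of unique product groups -/

/-- The class of `z` modulo the nilradical is idempotent and lifts to an idempotent of `C`, which
must be 0 or 1. -/
theorem isUnit_or_isNilpotent_of_isNilpotent_mul_one_sub {C : Type*} [CommRing C]
    (hC : ∀ e : C, e * e = e → e = 0 ∨ e = 1) {z : C} (hz : IsNilpotent (z * (1 - z))) :
    IsUnit z ∨ IsNilpotent z := by
  obtain ⟨e, he, hez⟩ := exists_isIdempotentElem_eq_of_ker_isNilpotent
    (Ideal.Quotient.mk (nilradical C)) (fun x hx => by
      rwa [Ideal.mk_ker, mem_nilradical] at hx)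
    (Ideal.Quotient.mk (nilradical C) z) ⟨z, rfl⟩ (by
      rw [IsIdempotentElem, ← map_mul, Ideal.Quotient.eq, mem_nilradical]
      rw [← isNilpotent_neg_iff]
      convert hz using 1
      ring)
  rw [Ideal.Quotient.eq, mem_nilradical] at hez
  obtain rfl | rfl := hC e he
  · right
    rwa [zero_sub, isNilpotent_neg_iff] at hez
  · left
    have := hez.isUnit_one_sub
    rwa [sub_sub_cancel] at this

/-- A rank one family of elements `z a b` over a commutative ring with connected spectrum, indexed
by pairs in a unique product group, which convolves to the identity, is concentrated at a single
pair up to nilpotents. -/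
theorem exists_isUnit_of_uniqueProds {H C : Type*} [Group H] [DecidableEq H] [UniqueProds H]
    [CommRing C] [Nontrivial C] (hC : ∀ e : C, e * e = e → e = 0 ∨ e = 1) (X Y : Finset H) (z w : H → H → C)
    (hX : ∀ a b, a ∉ X → z a b = 0) (hY : ∀ a b, b ∉ Y → z a b = 0)
    (hz : ∀ a b a' b', z a b * z a' b' = w b a' * z a b')
    (hone : ∑ p ∈ X ×ˢ Y with p.1 * p.2 = 1, z p.1 p.2 = 1)
    (hzero : ∀ q ≠ 1, ∑ p ∈ X ×ˢ Y with p.1 * p.2 = q, z p.1 p.2 = 0) :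
    ∃ h, IsUnit (z h h⁻¹) ∧ ∀ a b, a ≠ h → IsNilpotent (z a b) := by
  classical
  have : TwoUniqueProds H := UniqueProds.toTwoUniqueProds_of_group
  have key : ∀ P : Ideal C, P.IsPrime → ∃ h, ∀ a b, z a b ∉ P → a = h ∧ b = h⁻¹ := by
    intro P hP
    set A := X.filter fun a => ∃ b, z a b ∉ P with hA
    set B := Y.filter fun b => ∃ a, z a b ∉ P with hB
    have hmA : ∀ a b, z a b ∉ P → a ∈ A := fun a b hab => Finset.mem_filter.2
      ⟨by by_contra h; exact hab (hX a b h ▸ P.zero_mem), b, hab⟩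
    have hmB : ∀ a b, z a b ∉ P → b ∈ B := fun a b hab => Finset.mem_filter.2
      ⟨by by_contra h; exact hab (hY a b h ▸ P.zero_mem), a, hab⟩
    -- By the rank one identity `z a b' * z a' b` is a multiple of `z a b`, so the pairs with value
    -- outside `P` fill the whole rectangle `A × B`.
    have hAB : ∀ a ∈ A, ∀ b ∈ B, z a b ∉ P := by
      intro a ha b hb hab
      obtain ⟨b', h1⟩ := (Finset.mem_filter.1 ha).2
      obtain ⟨a', h2⟩ := (Finset.mem_filter.1 hb).2
      have := P.mul_mem_left (w b' a') hab
      rw [← hz] at this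
      exact (hP.mem_or_mem this).elim h1 h2
    -- Otherwise a vanishing sum would have exactly one term outside `P`.
    have hsub : ∀ a ∈ A, ∀ b ∈ B, UniqueMul A B a b → a * b = 1 := by
      intro a ha b hb hu
      by_contra hne
      apply hAB a ha b hb
      have h0 := hzero _ hne
      have hm : (a, b) ∈ (X ×ˢ Y).filter fun p : H × H => p.1 * p.2 = a * b :=
        Finset.mem_filter.2 ⟨Finset.mem_product.2
          ⟨(Finset.mem_filter.1 ha).1, (Finset.mem_filter.1 hb).1⟩, rfl⟩
      rw [← Finset.add_sum_erase _ _ hm] at h0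
      rw [eq_neg_of_add_eq_zero_left h0]
      refine P.neg_mem (P.sum_mem fun p hp => ?_)
      obtain ⟨hp1, hp2⟩ := Finset.mem_erase.1 hp
      by_contra hpP
      have := hu (hmA _ _ hpP) (hmB _ _ hpP) (Finset.mem_filter.1 hp2).2
      exact hp1 (Prod.ext this.1 this.2)
    obtain ⟨⟨h, g⟩, hp, hhP⟩ : ∃ p ∈ (X ×ˢ Y).filter (fun p : H × H => p.1 * p.2 = 1),
        z p.1 p.2 ∉ P := by
      by_contra hcon
      push Not at hcon
      apply hP.ne_top
      rw [Ideal.eq_top_iff_one, ← hone]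
      exact P.sum_mem hcon
    have hhg : h * g = 1 := (Finset.mem_filter.1 hp).2
    -- A larger rectangle has two distinct unique products; both would equal 1, contradicting their
    -- uniqueness.
    have hcard : A.card * B.card ≤ 1 := by
      by_contra hlt
      obtain ⟨p, hp, q, hq, hpq, hup, huq⟩ :=
        TwoUniqueProds.uniqueMul_of_one_lt_card (A := A) (B := B) (by omega)
      rw [Finset.mem_product] at hp hq
      have e1 := hsub _ hp.1 _ hp.2 hup
      have e2 := hsub _ hq.1 _ hq.2 huq
      have := hup hq.1 hq.2 (e2.trans e1.symm)
      exact hpq (Prod.ext this.1.symm this.2.symm)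
    rw [← Finset.card_product] at hcard
    refine ⟨h, fun a b hab => ?_⟩
    have := Finset.card_le_one.1 hcard (a, b)
      (Finset.mem_product.2 ⟨hmA _ _ hab, hmB _ _ hab⟩) (h, g)
      (Finset.mem_product.2 ⟨hmA _ _ hhP, hmB _ _ hhP⟩)
    rw [Prod.mk.injEq] at this
    exact ⟨this.1, this.2.trans (eq_inv_of_mul_eq_one_right hhg)⟩
  have hnil : ∀ c : C, (∀ P : Ideal C, P.IsPrime → c ∈ P) → IsNilpotent c := fun c hc =>
    nilpotent_iff_mem_prime.2 hc
  have horth : ∀ a b a' b', a ≠ a' → IsNilpotent (z a b * z a' b') := by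
    intro a b a' b' hne
    refine hnil _ fun P hP => ?_
    obtain ⟨h, hh⟩ := key P hP
    by_contra hmem
    exact hne ((hh a b fun hm => hmem (P.mul_mem_right _ hm)).1.trans
      (hh a' b' fun hm => hmem (P.mul_mem_left _ hm)).1.symm)
  have hone' : ∑ a ∈ X, z a a⁻¹ = 1 := by
    rw [← hone, Finset.sum_filter, Finset.sum_product]
    refine Finset.sum_congr rfl fun a _ => ?_
    by_cases ha : a⁻¹ ∈ Y
    · rw [Finset.sum_eq_single_of_mem _ ha, if_pos (mul_inv_cancel a)]
      intro b _ hb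
      exact if_neg fun e => hb (eq_inv_of_mul_eq_one_right e)
    · rw [hY _ _ ha, Finset.sum_eq_zero]
      intro b hb
      exact if_neg fun e : a * b = 1 => ha (eq_inv_of_mul_eq_one_right e ▸ hb)
  -- The elements `z a a⁻¹` sum to 1 and are orthogonal modulo nilpotents, so each is idempotent
  -- modulo nilpotents.
  have hdich : ∀ a ∈ X, IsUnit (z a a⁻¹) ∨ IsNilpotent (z a a⁻¹) := by
    intro a ha
    refine isUnit_or_isNilpotent_of_isNilpotent_mul_one_sub hC ?_
    rw [← hone', ← Finset.add_sum_erase _ _ ha, add_sub_cancel_left, Finset.mul_sum,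
      ← mem_nilradical]
    exact sum_mem fun b hb => mem_nilradical.2 (horth _ _ _ _ (Finset.ne_of_mem_erase hb).symm)
  obtain ⟨h, hu⟩ : ∃ h, IsUnit (z h h⁻¹) := by
    by_contra hcon
    push Not at hcon
    have : IsNilpotent (1 : C) := by
      rw [← hone', ← mem_nilradical]
      exact sum_mem fun a ha => mem_nilradical.2 ((hdich a ha).resolve_left (hcon a))
    exact not_isNilpotent_one this
  refine ⟨h, hu, fun a b hne => hnil _ fun P hP => ?_⟩
  obtain ⟨h', hh⟩ := key P hP
  by_contra hmem
  have e1 := (hh a b hmem).1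
  have e2 := (hh h h⁻¹ fun hm => hP.ne_top (Ideal.eq_top_of_isUnit_mem _ hm hu)).1
  exact hne (e1.trans e2.symm)

/-- `u` has exactly one unit value, and all its other values are multiples of that one by nilpotent
central elements. -/
def IsMonomialModNil {K : Type*} [Ring K] {H : Type*} (u : H → K) : Prop :=
  ∃ h, IsUnit (u h) ∧ ∀ g ≠ h, ∃ ζ ∈ Subring.center K, IsNilpotent ζ ∧ u g = ζ * u h

theorem MonoidAlgebra.coeff_mul_eq_sum_filter {K H : Type*} [Semiring K] [Mul H] [DecidableEq H]
    (u v : MonoidAlgebra K H) (q : H) :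
    (u * v).coeff q = ∑ p ∈ u.coeff.support ×ˢ v.coeff.support with p.1 * p.2 = q,
      u.coeff p.1 * v.coeff p.2 := by
  rw [MonoidAlgebra.coeff_mul, Finset.sum_filter, Finset.sum_product]
  rfl

/-- Normalising `K` forces all products `u(a) v(b)` into the centre of `K`, a commutative ring with
only trivial idempotents. There they form a rank one family convolving to the identity, to which the
preceding theorem applies. -/
theorem MonoidAlgebra.isMonomialModNil_of_uniqueProds {K : Type*} [Ring K]
    (hK : IsIndecomposableRing K) {H : Type*} [Group H] [UniqueProds H]
    {u v : MonoidAlgebra K H} (huv : u * v = 1) (hvu : v * u = 1)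
    (hu : ∀ k : K, ∃ k' : K, ∀ h, u.coeff h * k = k' * u.coeff h)
    (hv : ∀ k : K, ∃ k' : K, ∀ h, v.coeff h * k = k' * v.coeff h) :
    IsMonomialModNil u.coeff := by
  classical
  have := hK.1
  have cross : ∀ u v : MonoidAlgebra K H, u * v = 1 →
      (∀ k : K, ∃ k' : K, ∀ h, u.coeff h * k = k' * u.coeff h) →
      (∀ k : K, ∃ k' : K, ∀ h, v.coeff h * k = k' * v.coeff h) →
      ∀ a b, u.coeff a * v.coeff b ∈ Subring.center K := by
    intro u v huv hu hv a b
    rw [Subring.mem_center_iff]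
    intro d
    obtain ⟨d', hd'⟩ := hv d
    obtain ⟨d'', hd''⟩ := hu d'
    have hall : ∀ a b, u.coeff a * v.coeff b * d = d'' * (u.coeff a * v.coeff b) := fun a b => by
      rw [mul_assoc, hd', ← mul_assoc, hd'', mul_assoc]
    -- The twist `d''` does not depend on the pair, so summing over the pairs with product 1
    -- compares it with `d`.
    have h1 : d = d'' := by
      have h := congrArg (fun x => x.coeff 1) huv
      simp only [coeff_mul_eq_sum_filter, coeff_one_one] at h
      calc d = 1 * d := (one_mul d).symm
        _ = d'' * 1 := by
          rw [← h, Finset.sum_mul, Finset.mul_sum]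
          exact Finset.sum_congr rfl fun p _ => hall _ _
        _ = d'' := mul_one d''
    rw [hall, h1]
  have hC : ∀ e : Subring.center K, e * e = e → e = 0 ∨ e = 1 := by
    rintro ⟨e, he⟩ hee
    obtain h | h := hK.2 e (congrArg Subtype.val hee) (Subring.mem_center_iff.1 he)
    · exact Or.inl (Subtype.ext h)
    · exact Or.inr (Subtype.ext h)
  let z : H → H → Subring.center K := fun a b => ⟨_, cross u v huv hu hv a b⟩
  let w : H → H → Subring.center K := fun a b => ⟨_, cross v u hvu hv hu a b⟩
  have hsum : ∀ q, ((∑ p ∈ u.coeff.support ×ˢ v.coeff.support with p.1 * p.2 = q, z p.1 p.2 :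
      Subring.center K) : K) = (1 : MonoidAlgebra K H).coeff q := by
    intro q
    rw [← huv, coeff_mul_eq_sum_filter]
    push_cast
    rfl
  obtain ⟨h, hz, hnil⟩ := exists_isUnit_of_uniqueProds hC u.coeff.support v.coeff.support z w
    (fun a b ha => Subtype.ext (by
      show u.coeff a * v.coeff b = 0
      rw [Finsupp.notMem_support_iff.1 ha, zero_mul]))
    (fun a b hb => Subtype.ext (by
      show u.coeff a * v.coeff b = 0
      rw [Finsupp.notMem_support_iff.1 hb, mul_zero]))
    (fun a b a' b' => Subtype.ext (by
      show u.coeff a * v.coeff b * (u.coeff a' * v.coeff b') =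
        v.coeff b * u.coeff a' * (u.coeff a * v.coeff b')
      rw [mul_assoc, ← mul_assoc (v.coeff b),
        ← Subring.mem_center_iff.1 (cross v u hvu hv hu b a') , ← mul_assoc,
        ← Subring.mem_center_iff.1 (cross v u hvu hv hu b a')]))
    (Subtype.ext ((hsum 1).trans (by simp)))
    (fun q hq => Subtype.ext ((hsum q).trans (by
      rw [one_def, coeff_single, Finsupp.single_eq_of_ne hq]; rfl)))
  obtain ⟨c, hc⟩ := hz
  set a := u.coeff h with ha
  set b := v.coeff h⁻¹ with hb
  have hcu : (c : Subring.center K).1 = a * b := congrArg Subtype.val hc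
  set t : K := ((c⁻¹ : (Subring.center K)ˣ) : Subring.center K).1 with ht
  have htc : ∀ y, y * t = t * y :=
    Subring.mem_center_iff.1 ((c⁻¹ : (Subring.center K)ˣ) : Subring.center K).2
  have h1 : a * b * t = 1 := by
    rw [← hcu]
    exact congrArg Subtype.val c.mul_inv
  have hba : ∀ y, y * (b * a) = (b * a) * y :=
    Subring.mem_center_iff.1 (cross v u hvu hv hu h⁻¹ h)
  -- The unit `c` yields only `a b t = 1`. The reverse relation uses indecomposability: `t b a` is a
  -- central idempotent, and its vanishing would give `1 = 0`.
  have h2 : t * (b * a) = 1 := by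
    have hid : t * (b * a) * (t * (b * a)) = t * (b * a) := by
      calc t * (b * a) * (t * (b * a)) = t * (b * (a * t) * b * a) := by simp only [mul_assoc]
        _ = t * (b * (t * a) * b * a) := by rw [htc a]
        _ = t * (b * ((t * (a * b)) * a)) := by simp only [mul_assoc]
        _ = t * (b * a) := by rw [← htc (a * b), h1, one_mul]
    refine (hK.2 _ hid fun y => ?_).resolve_left fun h0 => ?_
    · rw [← mul_assoc, htc, mul_assoc, hba, ← mul_assoc]
    · have : (1 : K) = 0 := by
        calc (1 : K) = a * b * t * (a * b * t) := by rw [h1, one_mul]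
          _ = a * (b * t * a) * (b * t) := by simp only [mul_assoc]
          _ = a * (t * (b * a)) * (b * t) := by rw [htc b, mul_assoc t]
          _ = 0 := by rw [h0, mul_zero, zero_mul]
      exact one_ne_zero this
  refine ⟨h, ?_, fun g hg => ?_⟩
  · exact ⟨⟨a, b * t, by rw [← mul_assoc, h1], by rw [htc, mul_assoc, h2]⟩, rfl⟩
  · refine ⟨(z g h⁻¹ * ((c⁻¹ : (Subring.center K)ˣ) : Subring.center K) : Subring.center K),
      Subtype.property _, ?_, ?_⟩
    · exact ((Commute.all _ _).isNilpotent_mul_right (hnil g h⁻¹ hg)).map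
        (Subring.center K).subtype
    · show u.coeff g = u.coeff g * b * t * a
      rw [mul_assoc, mul_assoc, ← mul_assoc b, htc b, mul_assoc t, h2, mul_one]

/-! ### From the isotropy conditions to monomial units -/

namespace ArrowGroupoid

/-- Every unit of a group ring `K[H_x]` that normalises `K` is a unit multiple of a group element
up to nilpotents. -/
def HasMonomialUnits (K : Type v) [Ring K] (G : Type u) [TopologicalSpace G] [ArrowGroupoid G]
    [IsEtale G] : Prop :=
  ∀ (x : units G) (u v : MonoidAlgebra K (IntIsotropy x)), u * v = 1 → v * u = 1 →
    (∀ k : K, ∃ k' : K, ∀ h, u.coeff h * k = k' * u.coeff h) →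
    (∀ k : K, ∃ k' : K, ∀ h, v.coeff h * k = k' * v.coeff h) → IsMonomialModNil u.coeff

/-- Serves the last two isotropy conditions, where a unit is carried by one group element and no
nilpotents occur; the inverse of its coefficient is read off from `v` at the inverse element. -/
theorem isMonomialModNil_of_support_subset {K : Type*} [Ring K] [Nontrivial K] {H : Type*} [Group H]
    {u v : MonoidAlgebra K H} (huv : u * v = 1) (hvu : v * u = 1)
    (hu : ∀ g h, u.coeff g ≠ 0 → u.coeff h ≠ 0 → g = h) : IsMonomialModNil u.coeff := by
  classical
  obtain ⟨h, hh⟩ : ∃ h, u.coeff h ≠ 0 := by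
    by_contra hcon
    push Not at hcon
    have h0 : u = 0 := MonoidAlgebra.ext (Finsupp.ext hcon)
    have h1 := congrArg (fun x => x.coeff 1) huv
    simp only [h0, zero_mul, MonoidAlgebra.coeff_one_one] at h1
    exact zero_ne_one h1
  have hz : ∀ g ≠ h, u.coeff g = 0 := fun g hg => by
    by_contra hne
    exact hg (hu g h hne hh)
  have hs : u = MonoidAlgebra.single h (u.coeff h) := by
    refine MonoidAlgebra.ext (Finsupp.ext fun g => ?_)
    rw [MonoidAlgebra.coeff_single]
    by_cases hg : g = h
    · rw [hg, Finsupp.single_eq_same]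
    · rw [Finsupp.single_eq_of_ne hg, hz g hg]
  refine ⟨h, ?_, fun g hg => ⟨0, Subring.zero_mem _, IsNilpotent.zero, by rw [hz g hg, zero_mul]⟩⟩
  refine ⟨⟨u.coeff h, v.coeff h⁻¹, ?_, ?_⟩, rfl⟩
  · have h1 := congrArg (fun x => x.coeff 1) huv
    simp only [MonoidAlgebra.coeff_one_one] at h1
    rw [hs, MonoidAlgebra.coeff_single_mul_eq_mul_coeff h⁻¹ (fun m _ => mul_eq_one_iff_inv_eq.trans
      eq_comm)] at h1
    exact h1
  · have h1 := congrArg (fun x => x.coeff 1) hvu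
    simp only [MonoidAlgebra.coeff_one_one] at h1
    rw [hs, MonoidAlgebra.coeff_mul_single_eq_coeff_mul h⁻¹
      (fun m _ => mul_eq_one_iff_eq_inv)] at h1
    exact h1

theorem IsotropyCondition.hasMonomialUnits {K : Type v} [Ring K] {G : Type u} [TopologicalSpace G]
    [ArrowGroupoid G] [IsEtale G] (hK : IsIndecomposableRing K) (hG : IsotropyCondition K G) :
    HasMonomialUnits K G := by
  have := hK.1
  have up : (∀ x : units G, UniqueProds (IntIsotropy x)) → HasMonomialUnits K G := by
    intro h x u v huv hvu hu hv
    have := h x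
    exact MonoidAlgebra.isMonomialModNil_of_uniqueProds hK huv hvu hu hv
  obtain h | h | h | h | h | h := hG
  · refine up fun x => ?_
    have : Subsingleton (IntIsotropy x) := by
      refine ⟨fun a b => IntIsotropy.ext ?_⟩
      have key : ∀ a : IntIsotropy x, a.val = x := fun a => by
        have hm : a.val ∈ units G := h ▸ a.mem_interior
        rw [← a.src_eq, src_eq_self_of_mem_units hm]
      rw [key a, key b]
    exact ⟨fun {A B} ⟨a, ha⟩ ⟨b, hb⟩ => ⟨a, ha, b, hb, UniqueMul.of_subsingleton⟩⟩
  · refine up fun x => ?_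
    obtain hx | hx := h x
    · exact IsFreeGroup.uniqueProds _
    · exact uniqueProds_of_comm_of_torsionFree hx.2 hx.1
  · refine up fun x => ?_
    obtain ⟨_, hx⟩ | ⟨_, hx⟩ := h x
    · exact uniqueProds_of_mul_le_mul_left hx
    · exact uniqueProds_of_mul_le_mul_right hx
  · exact up h
  · intro x u v huv hvu _ _
    obtain ⟨k, h', hk⟩ := h x ⟨u, v, huv, hvu⟩
    refine isMonomialModNil_of_support_subset huv hvu fun g h hg hh => ?_
    have hk' : u = MonoidAlgebra.single h' (k : K) := hk
    have hne : ∀ g, u.coeff g ≠ 0 → g = h' := fun g hg => by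
      by_contra hne
      apply hg
      rw [hk', MonoidAlgebra.coeff_single, Finsupp.single_eq_of_ne hne]
    rw [hne g hg, hne h hh]
  · intro x u v huv hvu _ _
    obtain ⟨a, ha, hau⟩ := h x ⟨u, v, huv, hvu⟩
    refine isMonomialModNil_of_support_subset huv hvu fun g h hg hh => ?_
    refine IntIsotropy.ext (ha.1 ?_ ?_ (g.src_eq.trans h.src_eq.symm))
    · rw [Function.mem_support, hau]; exact hg
    · rw [Function.mem_support, hau]; exact hh

/-! ### Rebuilding a groupoid from its compact open bisections -/

section Stone

variable {G : Type*} [ArrowGroupoid G]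

theorem eq_src_of_mul_eq {a b : G} (h : src a = rng b) (e : mul a b = a) : b = src a := by
  have := mul_assoc (inv a) a b (src_inv a) h
  rwa [inv_mul, h, rng_mul_self, e, inv_mul] at this

theorem eq_rng_of_mul_eq {a b : G} (h : src a = rng b) (e : mul a b = b) : a = rng b := by
  have := mul_mul_inv h
  rwa [e, mul_inv, eq_comm] at this

/-- The family `β` enumerates the compact open bisections, compatibly with products. -/
structure IsBisectionBasis [TopologicalSpace G] {S : Type*} [Mul S] (β : S → Set G) : Prop where
  isOpen : ∀ n, IsOpen (β n)
  isCompact : ∀ n, IsCompact (β n)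
  isBisection : ∀ n, IsBisection (β n)
  exists_eq : ∀ B, IsOpen B → IsCompact B → IsBisection B → ∃ n, β n = B
  mem_mul : ∀ n m k, k ∈ β (n * m) ↔ ∃ g ∈ β n, ∃ h ∈ β m, src g = rng h ∧ mul g h = k

namespace IsBisectionBasis

variable [TopologicalSpace G] {S : Type*} [Mul S] {β : S → Set G}
  {G' : Type*} [ArrowGroupoid G'] [TopologicalSpace G']
  {S' : Type*} [Mul S'] {β' : S' → Set G'}

theorem exists_mem_subset [IsAmple G] (hβ : IsBisectionBasis β) {g : G} {U : Set G} (hU : IsOpen U)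
    (hg : g ∈ U) : ∃ n, g ∈ β n ∧ β n ⊆ U := by
  obtain ⟨B, ⟨h1, h2, h3⟩, h4, h5⟩ := IsAmple.isTopologicalBasis.exists_subset_of_mem_open hg hU
  obtain ⟨n, rfl⟩ := hβ.exists_eq B h1 h2 h3
  exact ⟨n, h4, h5⟩

theorem continuous_of_forall_mem [IsAmple G'] (hβ : IsBisectionBasis β) (hβ' : IsBisectionBasis β')
    (φ : S ≃* S') {f : G → G'} (hf : ∀ g n, g ∈ β n ↔ f g ∈ β' (φ n)) : Continuous f := by
  rw [continuous_iff_continuousAt]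
  intro g
  rw [ContinuousAt, Filter.tendsto_def]
  intro U hU
  obtain ⟨V, hVU, hV, hgV⟩ := mem_nhds_iff.1 hU
  obtain ⟨p, h1, h2⟩ := hβ'.exists_mem_subset hV hgV
  obtain ⟨n, rfl⟩ := φ.surjective p
  filter_upwards [(hβ.isOpen n).mem_nhds ((hf g n).2 h1)] with k hk
  exact hVU (h2 ((hf k n).1 hk))

theorem exists_mem_disjoint [IsAmple G] [T2Space G] (hβ : IsBisectionBasis β) {g : G} {n : S}
    (hg : g ∉ β n) :
    ∃ m, g ∈ β m ∧ Disjoint (β m) (β n) := by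
  obtain ⟨m, h1, h2⟩ := hβ.exists_mem_subset (hβ.isCompact n).isClosed.isOpen_compl hg
  exact ⟨m, h1, Set.disjoint_left.2 h2⟩

theorem eq_of_forall_mem [IsAmple G] [T2Space G] (hβ : IsBisectionBasis β) {g h : G}
    (H : ∀ n, g ∈ β n → h ∈ β n) :
    g = h := by
  by_contra hne
  obtain ⟨n, h1, h2⟩ := hβ.exists_mem_subset (isOpen_compl_singleton (x := h)) hne
  exact h2 (H n h1) rfl

theorem subset_of_forall_disjoint [IsAmple G] [T2Space G] (hβ : IsBisectionBasis β) {n m : S}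
    (H : ∀ p, Disjoint (β p) (β m) → Disjoint (β p) (β n)) : β n ⊆ β m := by
  intro g hg
  by_contra hgm
  obtain ⟨p, h1, h2⟩ := hβ.exists_mem_disjoint hgm
  exact Set.disjoint_left.1 (H p h2) h1 hg

variable [IsAmple G'] [T2Space G']

/-- The bisections containing `g` are directed downwards and nonempty. Their images are compact with
the same properties, hence share a point. Membership is reflected because a bisection missing `g` is
disjoint from some bisection containing it. -/
theorem exists_point [IsAmple G] [T2Space G] (hβ : IsBisectionBasis β)
    (hβ' : IsBisectionBasis β') (φ : S ≃* S')
    (hφ : ∀ n m, Disjoint (β n) (β m) ↔ Disjoint (β' (φ n)) (β' (φ m))) (g : G) :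
    ∃ g', ∀ n, g ∈ β n ↔ g' ∈ β' (φ n) := by
  -- Inclusion is encoded by disjointness: a compact open set contains another as soon as everything
  -- disjoint from the first is disjoint from the second.
  have mono : ∀ n m, β n ⊆ β m → β' (φ n) ⊆ β' (φ m) := by
    intro n m h
    refine hβ'.subset_of_forall_disjoint fun p hp => ?_
    obtain ⟨q, rfl⟩ := φ.surjective p
    rw [← hφ] at hp ⊢
    exact hp.mono_right h
  have hne : Nonempty {n // g ∈ β n} := by
    obtain ⟨n, hn, _⟩ := hβ.exists_mem_subset isOpen_univ (Set.mem_univ g)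
    exact ⟨n, hn⟩
  obtain ⟨g', hg'⟩ := IsCompact.nonempty_iInter_of_directed_nonempty_isCompact_isClosed
    (fun n : {n // g ∈ β n} => β' (φ n.1)) (by
      rintro ⟨n, hn⟩ ⟨m, hm⟩
      obtain ⟨p, hp⟩ := hβ.exists_eq (β n ∩ β m) ((hβ.isOpen n).inter (hβ.isOpen m))
        ((hβ.isCompact n).inter (hβ.isCompact m))
        ⟨(hβ.isBisection n).1.mono Set.inter_subset_left,
          (hβ.isBisection n).2.mono Set.inter_subset_left⟩
      have hgp : g ∈ β p := hp.symm ▸ ⟨hn, hm⟩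
      exact ⟨⟨p, hgp⟩, mono _ _ (hp.subset.trans Set.inter_subset_left),
        mono _ _ (hp.subset.trans Set.inter_subset_right)⟩)
    (by
      rintro ⟨n, hn⟩
      by_contra hemp
      rw [Set.not_nonempty_iff_eq_empty, ← Set.bot_eq_empty, ← disjoint_self, ← hφ,
        disjoint_self] at hemp
      exact absurd hn (hemp ▸ Set.notMem_empty g))
    (fun n => hβ'.isCompact _) (fun n => (hβ'.isCompact _).isClosed)
  have hg'' : ∀ n, g ∈ β n → g' ∈ β' (φ n) := fun n hn => Set.mem_iInter.1 hg' ⟨n, hn⟩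
  refine ⟨g', fun n => ⟨hg'' n, fun h => ?_⟩⟩
  by_contra hn
  obtain ⟨p, h1, h2⟩ := hβ.exists_mem_disjoint hn
  exact Set.disjoint_left.1 ((hφ p n).1 h2) (hg'' p h1) h

/-- If the two units differed, bisections around `f g` and `f h` with separated sources and ranges
would have empty product, yet that product contains `f (mul g h)`. -/
theorem src_eq_rng_map (hβ : IsBisectionBasis β) (hβ' : IsBisectionBasis β')
    (φ : S ≃* S') {f : G → G'} (hf : ∀ g n, g ∈ β n ↔ f g ∈ β' (φ n)) {g h : G}
    (e : src g = rng h) : src (f g) = rng (f h) := by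
  by_contra hne
  obtain ⟨U, V, hU, hV, hgU, hhV, hUV⟩ := t2_separation hne
  obtain ⟨n', hn1, hn2⟩ := hβ'.exists_mem_subset (hU.preimage continuous_src) hgU
  obtain ⟨m', hm1, hm2⟩ := hβ'.exists_mem_subset (hV.preimage continuous_rng) hhV
  obtain ⟨n, rfl⟩ := φ.surjective n'
  obtain ⟨m, rfl⟩ := φ.surjective m'
  have hm : f (mul g h) ∈ β' (φ n * φ m) := by
    rw [← map_mul, ← hf]
    exact (hβ.mem_mul _ _ _).2 ⟨g, (hf g n).2 hn1, h, (hf h m).2 hm1, e, rfl⟩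
  obtain ⟨a, ha, b, hb, hab, _⟩ := (hβ'.mem_mul _ _ _).1 hm
  have ha' : src a ∈ U := hn2 ha
  rw [hab] at ha'
  exact Set.disjoint_left.1 hUV ha' (hm2 hb)

/-- By continuity, any bisection around `mul (f g) (f h)` contains a product of small bisections
around the factors, and that product already contains `f (mul g h)`. -/
theorem map_mul_eq (hβ : IsBisectionBasis β) (hβ' : IsBisectionBasis β')
    (φ : S ≃* S') {f : G → G'} (hf : ∀ g n, g ∈ β n ↔ f g ∈ β' (φ n)) {g h : G}
    (e : src g = rng h) : f (mul g h) = mul (f g) (f h) := by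
  symm
  refine hβ'.eq_of_forall_mem fun p hp => ?_
  have hc := IsEtale.continuousOn_mul (G := G') (f g, f h) (hβ.src_eq_rng_map hβ' φ hf e)
  have hev := hc ((hβ'.isOpen p).mem_nhds hp)
  rw [Filter.mem_map, mem_nhdsWithin_iff_exists_mem_nhds_inter] at hev
  obtain ⟨W, hW, hWp⟩ := hev
  obtain ⟨U, V, hU, hgU, hV, hhV, hUV⟩ := mem_nhds_prod_iff'.1 hW
  obtain ⟨n', hn1, hn2⟩ := hβ'.exists_mem_subset hU hgU
  obtain ⟨m', hm1, hm2⟩ := hβ'.exists_mem_subset hV hhV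
  obtain ⟨n, rfl⟩ := φ.surjective n'
  obtain ⟨m, rfl⟩ := φ.surjective m'
  have hm : f (mul g h) ∈ β' (φ n * φ m) := by
    rw [← map_mul, ← hf]
    exact (hβ.mem_mul _ _ _).2 ⟨g, (hf g n).2 hn1, h, (hf h m).2 hm1, e, rfl⟩
  obtain ⟨a, ha, b, hb, hab, hk⟩ := (hβ'.mem_mul _ _ _).1 hm
  rw [← hk]
  have hmem : (a, b) ∈ W := hUV ⟨hn2 ha, hm2 hb⟩
  exact hWp ⟨hmem, hab⟩

theorem nonempty_topIso [IsAmple G] [T2Space G] (hβ : IsBisectionBasis β)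
    (hβ' : IsBisectionBasis β') (φ : S ≃* S')
    (hφ : ∀ n m, Disjoint (β n) (β m) ↔ Disjoint (β' (φ n)) (β' (φ m))) :
    Nonempty (TopIso G G') := by
  choose f hf using hβ.exists_point hβ' φ hφ
  choose f' hf' using hβ'.exists_point hβ φ.symm fun n m => by
    rw [hφ, φ.apply_symm_apply, φ.apply_symm_apply]
  have hcomp : ∀ {g h : G}, src g = rng h → src (f g) = rng (f h) :=
    fun e => hβ.src_eq_rng_map hβ' φ hf e
  have hmul : ∀ {g h : G}, src g = rng h → f (mul g h) = mul (f g) (f h) :=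
    fun e => hβ.map_mul_eq hβ' φ hf e
  refine ⟨{ toFun := f, invFun := f', left_inv := fun g => ?_, right_inv := fun g => ?_,
            continuous_toFun := hβ.continuous_of_forall_mem hβ' φ hf
            continuous_invFun := hβ'.continuous_of_forall_mem hβ φ.symm hf'
            map_src := fun g => ?_, map_rng := fun g => ?_, map_mul := fun g h e => hmul e }⟩
  · refine (hβ.eq_of_forall_mem fun n hn => ?_).symm
    have := (hf' (f g) (φ n)).1 ((hf g n).1 hn)
    rwa [φ.symm_apply_apply] at this
  · refine (hβ'.eq_of_forall_mem fun n hn => ?_).symm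
    have := (hf (f' g) (φ.symm n)).1 ((hf' g n).1 hn)
    rwa [φ.apply_symm_apply] at this
  -- Sources and ranges are recovered from multiplication alone, as the right and left identities of
  -- an arrow.
  · have e : src g = rng (src g) := (rng_src g).symm
    exact eq_src_of_mul_eq (hcomp e) (by rw [← hmul e, mul_src])
  · have e : src (rng g) = rng g := src_rng g
    exact eq_rng_of_mul_eq (hcomp e) (by rw [← hmul e, rng_mul_self])

end IsBisectionBasis

end Stone

/-! ### Arrow identities and convolution with diagonal functions -/

section Algebra

variable {G : Type*} [ArrowGroupoid G]

theorem inv_mul_rev {g h : G} (e : src g = rng h) : inv (mul g h) = mul (inv h) (inv g) := by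
  have e' : src (inv h) = rng (inv g) := by rw [src_inv, rng_inv, e]
  have h1 : mul (inv h) (inv g) = mul (inv (mul g h)) (mul (mul g h) (mul (inv h) (inv g))) := by
    rw [← mul_assoc _ _ _ (src_inv _) (by rw [src_mul _ _ e, rng_mul _ _ e', rng_inv]), inv_mul,
      src_mul _ _ e, ← rng_inv, ← rng_mul _ _ e', rng_mul_self]
  rw [h1, ← mul_assoc _ _ _ (by rw [src_mul _ _ e, rng_inv]) e', mul_mul_inv e, mul_inv,
    ← rng_mul _ _ e, ← src_inv, mul_src]

theorem inv_mul_mul {g h : G} (e : src g = rng h) : mul (inv g) (mul g h) = h := by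
  rw [← mul_assoc _ _ _ (src_inv g) e, inv_mul, e, rng_mul_self]

theorem inv_eq_self_of_mem_units {x : G} (hx : x ∈ units G) : inv x = x := by
  have h1 := inv_mul x
  have h2 := mul_src (inv x)
  rw [src_inv, rng_eq_self_of_mem_units hx] at h2
  rw [← h2, h1, src_eq_self_of_mem_units hx]

theorem src_mem_units (g : G) : src g ∈ units G := ⟨g, rfl⟩

theorem rng_mem_units (g : G) : rng g ∈ units G := ⟨rng g, src_rng g⟩

theorem eq_of_inv_mul_mem_units {g h : G} (e : rng h = rng g) (hu : mul (inv h) g ∈ units G) :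
    h = g := by
  have h1 : src (inv h) = rng g := by rw [src_inv, e]
  have h2 := mul_inv_mul_self e
  rw [← src_eq_self_of_mem_units hu, src_mul _ _ h1] at h2
  have h3 := rng_eq_self_of_mem_units hu
  rw [rng_mul _ _ h1, rng_inv, ← src_eq_self_of_mem_units hu, src_mul _ _ h1] at h3
  rw [← h2, ← h3, mul_src]

section Conv

variable {K : Type*} [Ring K]

theorem conv_eq_sum {a b : G → K} {g : G} (F : Finset G) (hF : ∀ h ∈ F, rng h = rng g)
    (hF' : ∀ h, rng h = rng g → a h * b (mul (inv h) g) ≠ 0 → h ∈ F) :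
    conv a b g = ∑ h ∈ F, a h * b (mul (inv h) g) := by
  classical
  unfold conv
  rw [finsum_eq_sum_of_support_subset (s := F)]
  · exact Finset.sum_congr rfl fun h hh => by rw [finsum_eq_if, if_pos (hF h hh)]
  · intro h hh
    rw [Function.mem_support, finsum_eq_if] at hh
    split_ifs at hh with e
    · exact hF' h e hh
    · exact absurd rfl hh

theorem conv_eq_single {a b : G → K} {g : G} (h : G) (hr : rng h = rng g)
    (hF' : ∀ k, rng k = rng g → k ≠ h → a k * b (mul (inv k) g) = 0) :
    conv a b g = a h * b (mul (inv h) g) := by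
  rw [conv_eq_sum {h} (by simpa using hr), Finset.sum_singleton]
  intro k hk hne
  by_contra hkh
  exact hne (hF' k hk (by simpa using hkh))

theorem conv_diag_left {d a : G → K} (hd : Function.support d ⊆ units G) (g : G) :
    conv d a g = d (rng g) * a g := by
  rw [conv_eq_single (rng g) (rng_rng g), inv_eq_self_of_mem_units (rng_mem_units g), rng_mul_self]
  intro k hk hne
  have : d k = 0 := by
    by_contra h
    exact hne ((rng_eq_self_of_mem_units (hd h)).symm.trans hk)
  rw [this, zero_mul]

theorem conv_diag_right {a d : G → K} (hd : Function.support d ⊆ units G) (g : G) :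
    conv a d g = a g * d (src g) := by
  rw [conv_eq_single g rfl, inv_mul]
  intro k hk hne
  have : d (mul (inv k) g) = 0 := by
    by_contra h
    exact hne (eq_of_inv_mul_mem_units hk (hd h))
  rw [this, mul_zero]

theorem exists_of_conv_ne_zero {a b : G → K} {g : G} (h : conv a b g ≠ 0) :
    ∃ k, rng k = rng g ∧ a k ≠ 0 ∧ b (mul (inv k) g) ≠ 0 := by
  by_contra hcon
  push Not at hcon
  apply h
  rw [conv_eq_sum ∅ (by simp), Finset.sum_empty]
  intro k hk hne
  exact absurd (hcon k hk (left_ne_zero_of_mul hne)) (right_ne_zero_of_mul hne)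

end Conv

end Algebra

/-! ### The convolution semigroup and its diagonal idempotents -/

namespace SteinbergAlgebra

variable {K : Type*} [Ring K] {G : Type*} [TopologicalSpace G]

theorem isCompact_support (a : SteinbergAlgebra K G) : IsCompact (Function.support a.toFun) := by
  have hcl : IsClosed (Function.support a.toFun) := by
    rw [← isOpen_compl_iff]
    have : (Function.support a.toFun)ᶜ = a.toFun ⁻¹' {0} := by ext; simp
    rw [this]
    exact a.isLocallyConstant _
  have := a.hasCompactSupport.isCompact
  rwa [tsupport, hcl.closure_eq] at this

theorem isOpen_support (a : SteinbergAlgebra K G) : IsOpen (Function.support a.toFun) :=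
  a.isLocallyConstant {0}ᶜ

theorem finite_range (a : SteinbergAlgebra K G) : (Set.range a.toFun).Finite := by
  have hc := a.isCompact_support
  obtain ⟨t, ht⟩ := hc.elim_finite_subcover (fun c : K => {g | a.toFun g = c})
    (fun c => a.isLocallyConstant.isOpen_fiber c) (fun g _ => Set.mem_iUnion.2 ⟨a.toFun g, rfl⟩)
  refine (t.finite_toSet.union (Set.finite_singleton 0)).subset ?_
  rintro _ ⟨g, rfl⟩
  by_cases hg : a.toFun g = 0
  · exact Or.inr hg
  · obtain ⟨c, hc, hgc⟩ := Set.mem_iUnion₂.1 (ht hg)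
    have : a.toFun g = c := hgc
    exact Or.inl (this ▸ hc)

open Classical in
/-- The function with value `k` on the compact open set `U` and `0` elsewhere. -/
noncomputable def ind [T2Space G] (U : Set G) (hU : IsOpen U) (hc : IsCompact U) (k : K) :
    SteinbergAlgebra K G where
  toFun g := if g ∈ U then k else 0
  isLocallyConstant := by
    rw [IsLocallyConstant.iff_eventually_eq]
    intro g
    by_cases hg : g ∈ U
    · filter_upwards [hU.mem_nhds hg] with h hh
      rw [if_pos hg, if_pos hh]
    · filter_upwards [hc.isClosed.isOpen_compl.mem_nhds hg] with h hh
      rw [if_neg hg, if_neg hh]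
  hasCompactSupport := HasCompactSupport.intro hc fun g hg => if_neg hg

section Ind

variable [T2Space G] {U : Set G} (hU : IsOpen U) (hc : IsCompact U) (k : K) {g : G}

theorem ind_of_mem (hg : g ∈ U) : (ind U hU hc k).toFun g = k := if_pos hg

theorem ind_of_notMem (hg : g ∉ U) : (ind U hU hc k).toFun g = 0 := if_neg hg

theorem support_ind_subset : Function.support (ind U hU hc k).toFun ⊆ U := fun _ hg => by
  by_contra h
  exact hg (ind_of_notMem hU hc k h)

end Ind

variable [ArrowGroupoid G]

theorem finite_fiber_rng [IsEtale G] (a : SteinbergAlgebra K G) (x : G) :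
    (Function.support a.toFun ∩ {h | rng h = x}).Finite := by
  choose e he hee using isLocalHomeomorph_rng (G := G)
  have hef : ∀ h k, e h k = rng k := fun h k => congrFun (hee h).symm k
  obtain ⟨t, ht⟩ := a.isCompact_support.elim_finite_subcover (fun h => (e h).source)
    (fun h => (e h).open_source) (fun h _ => Set.mem_iUnion.2 ⟨h, he h⟩)
  refine (t.finite_toSet.biUnion (t := fun i => (e i).source ∩ {h | rng h = x})
    fun i _ => ?_).subset ?_
  · refine Set.Subsingleton.finite ?_
    rintro y ⟨hy, hy'⟩ z ⟨hz, hz'⟩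
    apply (e i).injOn hy hz
    rw [hef, hef]
    exact hy'.trans hz'.symm
  · rintro y ⟨hy, hy'⟩
    obtain ⟨i, hi, hi'⟩ := Set.mem_iUnion₂.1 (ht hy)
    exact Set.mem_iUnion₂.2 ⟨i, hi, hi', hy'⟩

theorem apply_eq_zero {d : SteinbergAlgebra K G} (hd : d ∈ diagonal K G) {g : G}
    (hg : g ∉ units G) : d.toFun g = 0 := by
  by_contra h
  exact hg (hd h)

theorem exists_compact_open [IsAmple G] {x : G} {U : Set G} (hU : IsOpen U) (hx : x ∈ U) :
    ∃ W, IsOpen W ∧ IsCompact W ∧ IsBisection W ∧ x ∈ W ∧ W ⊆ U := by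
  obtain ⟨B, ⟨h1, h2, h3⟩, h4, h5⟩ := IsAmple.isTopologicalBasis.exists_subset_of_mem_open hx hU
  exact ⟨B, h1, h2, h3, h4, h5⟩

theorem ind_mem_diagonal [T2Space G] {U : Set G} (hU : IsOpen U) (hc : IsCompact U) (k : K)
    (h : U ⊆ units G) : ind U hU hc k ∈ diagonal K G :=
  (support_ind_subset hU hc k).trans h

variable [IsAmple G] [T2Space G]

theorem mul_toFun (a b : SteinbergAlgebra K G) : (a * b).toFun = conv a.toFun b.toFun := rfl

theorem mul_assoc' (a b c : SteinbergAlgebra K G) : a * b * c = a * (b * c) := by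
  classical
  refine SteinbergAlgebra.ext (funext fun g => ?_)
  rw [mul_toFun, mul_toFun a (b * c)]
  set F₁ : Finset G := (a.finite_fiber_rng (rng g)).toFinset with hF₁
  have hm₁ : ∀ k, k ∈ F₁ ↔ a.toFun k ≠ 0 ∧ rng k = rng g := by intro k; simp [hF₁]
  let F₂ : G → Finset G := fun k => (b.finite_fiber_rng (src k)).toFinset
  have hm₂ : ∀ k l, l ∈ F₂ k ↔ b.toFun l ≠ 0 ∧ rng l = src k := by intro k l; simp [F₂]
  -- All arrows `k l` with range `rng g`, `a k ≠ 0` and `b l ≠ 0`: one finite index set over which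
  -- both double sums can be written and interchanged.
  set F₃ : Finset G := F₁.biUnion fun k => (F₂ k).image (mul k) with hF₃
  have hm₃ : ∀ h ∈ F₃, rng h = rng g := by
    intro h hh
    obtain ⟨k, hk, hh⟩ := Finset.mem_biUnion.1 hh
    obtain ⟨l, hl, rfl⟩ := Finset.mem_image.1 hh
    rw [rng_mul _ _ ((hm₂ k l).1 hl).2.symm, ((hm₁ k).1 hk).2]
  have hab : ∀ h ∈ F₃, (a * b).toFun h = ∑ k ∈ F₁, a.toFun k * b.toFun (mul (inv k) h) := by
    intro h hh
    rw [mul_toFun, conv_eq_sum F₁]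
    · intro k hk
      rw [((hm₁ k).1 hk).2, hm₃ h hh]
    · intro k hk hne
      exact (hm₁ k).2 ⟨left_ne_zero_of_mul hne, hk.trans (hm₃ h hh)⟩
  have hbc : ∀ k ∈ F₁, (b * c).toFun (mul (inv k) g) =
      ∑ h ∈ F₃, b.toFun (mul (inv k) h) * c.toFun (mul (inv h) g) := by
    intro k hk
    have hkg := ((hm₁ k).1 hk).2
    have e1 : ∀ h ∈ F₃, src (inv k) = rng h := fun h hh => by rw [src_inv, hkg, hm₃ h hh]
    have e2 : src (inv k) = rng g := by rw [src_inv, hkg]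
    have hinj : Set.InjOn (mul (inv k)) (F₃ : Set G) := by
      intro h hh h' hh' he
      have := congrArg (mul k) he
      rwa [mul_inv_mul_self (hkg.trans (hm₃ h hh).symm),
        mul_inv_mul_self (hkg.trans (hm₃ h' hh').symm)] at this
    rw [mul_toFun, conv_eq_sum (F₃.image (mul (inv k))), Finset.sum_image hinj]
    · refine Finset.sum_congr rfl fun h hh => ?_
      have e3 := e1 h hh
      rw [inv_mul_rev e3, inv_inv, mul_assoc _ _ _ (by rw [src_inv, hkg, hm₃ h hh])
        (by rw [rng_mul _ _ e2, rng_inv]), mul_inv_mul_self hkg]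
    · intro l hl
      obtain ⟨h, hh, rfl⟩ := Finset.mem_image.1 hl
      rw [rng_mul _ _ (e1 h hh), rng_mul _ _ e2]
    · intro l hl hne
      rw [rng_mul _ _ e2, rng_inv] at hl
      refine Finset.mem_image.2 ⟨mul k l, Finset.mem_biUnion.2 ⟨k, hk, Finset.mem_image.2
        ⟨l, (hm₂ k l).2 ⟨left_ne_zero_of_mul hne, hl⟩, rfl⟩⟩, inv_mul_mul hl.symm⟩
  rw [conv_eq_sum F₃ hm₃, conv_eq_sum F₁ (fun k hk => ((hm₁ k).1 hk).2)
    (fun k hk hne => (hm₁ k).2 ⟨left_ne_zero_of_mul hne, hk⟩)]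
  · calc ∑ h ∈ F₃, (a * b).toFun h * c.toFun (mul (inv h) g)
        = ∑ h ∈ F₃, ∑ k ∈ F₁,
          a.toFun k * (b.toFun (mul (inv k) h) * c.toFun (mul (inv h) g)) := by
          refine Finset.sum_congr rfl fun h hh => ?_
          rw [hab h hh, Finset.sum_mul]
          exact Finset.sum_congr rfl fun k _ => _root_.mul_assoc _ _ _
      _ = ∑ k ∈ F₁, a.toFun k * (b * c).toFun (mul (inv k) g) := by
          rw [Finset.sum_comm]
          refine Finset.sum_congr rfl fun k hk => ?_
          rw [hbc k hk, Finset.mul_sum]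
  · intro h hh hne
    obtain ⟨k, hk, h1, h2⟩ := exists_of_conv_ne_zero (left_ne_zero_of_mul hne)
    refine Finset.mem_biUnion.2 ⟨k, (hm₁ k).2 ⟨h1, hk.trans hh⟩, Finset.mem_image.2
      ⟨mul (inv k) h, (hm₂ _ _).2 ⟨h2, ?_⟩, mul_inv_mul_self hk⟩⟩
    rw [rng_mul _ _ (by rw [src_inv, hk]), rng_inv]

noncomputable instance : Semigroup (SteinbergAlgebra K G) where
  mul_assoc := mul_assoc'

/-- `e` is an idempotent of the diagonal commuting with the diagonal. -/
structure IsDiagIdem (e : SteinbergAlgebra K G) : Prop where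
  mem_diagonal : e ∈ diagonal K G
  mul_self : e * e = e
  comm : ∀ d ∈ diagonal K G, d * e = e * d

theorem diag_mul_apply {d a : SteinbergAlgebra K G} (hd : d ∈ diagonal K G) (g : G) :
    (d * a).toFun g = d.toFun (rng g) * a.toFun g := conv_diag_left hd g

theorem mul_diag_apply {a d : SteinbergAlgebra K G} (hd : d ∈ diagonal K G) (g : G) :
    (a * d).toFun g = a.toFun g * d.toFun (src g) := conv_diag_right hd g

theorem isDiagIdem_of_apply {e : SteinbergAlgebra K G} (he : e ∈ diagonal K G)
    (h : ∀ g, e.toFun g = 0 ∨ e.toFun g = 1) : IsDiagIdem e where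
  mem_diagonal := he
  mul_self := by
    refine SteinbergAlgebra.ext (funext fun g => ?_)
    rw [diag_mul_apply he]
    by_cases hg : g ∈ units G
    · rw [rng_eq_self_of_mem_units hg]
      obtain h | h := h g <;> simp [h]
    · rw [apply_eq_zero he hg, mul_zero]
  comm d hd := by
    refine SteinbergAlgebra.ext (funext fun g => ?_)
    rw [diag_mul_apply he, mul_diag_apply he]
    by_cases hg : g ∈ units G
    · rw [rng_eq_self_of_mem_units hg, src_eq_self_of_mem_units hg]
      obtain h | h := h g <;> simp [h]
    · rw [apply_eq_zero hd hg, mul_zero, zero_mul]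

/-- On units the diagonal multiplies pointwise. Commuting with indicators of arbitrary value `y`
makes the value of `e` a central idempotent of `K`. -/
theorem IsDiagIdem.apply (hK : IsIndecomposableRing K) {e : SteinbergAlgebra K G}
    (he : IsDiagIdem e) (g : G) : e.toFun g = 0 ∨ e.toFun g = 1 := by
  by_cases hg : g ∈ units G
  · refine hK.2 _ ?_ fun y => ?_
    · have := congrArg (fun a => a.toFun g) he.mul_self
      simpa only [diag_mul_apply he.mem_diagonal, rng_eq_self_of_mem_units hg] using this
    · obtain ⟨W, hW, hWc, -, hgW, hWu⟩ := exists_compact_open (isOpen_units (G := G)) hg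
      have hd := ind_mem_diagonal hW hWc y hWu
      have := congrArg (fun a => a.toFun g) (he.comm _ hd)
      simpa only [diag_mul_apply hd, diag_mul_apply he.mem_diagonal, rng_eq_self_of_mem_units hg,
        ind_of_mem hW hWc y hgW] using this
  · exact Or.inl (apply_eq_zero he.mem_diagonal hg)

theorem isDiagIdem_ind {U : Set G} (hU : IsOpen U) (hc : IsCompact U) (h : U ⊆ units G) :
    IsDiagIdem (ind U hU hc (1 : K)) := by
  refine isDiagIdem_of_apply (ind_mem_diagonal hU hc 1 h) fun g => ?_
  by_cases hg : g ∈ U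
  · exact Or.inr (ind_of_mem hU hc 1 hg)
  · exact Or.inl (ind_of_notMem hU hc 1 hg)

end SteinbergAlgebra

/-! ### Normalizers and their restrictions to interior isotropy -/

/-- A local section of the source map through `h` factors every arrow near `mul g h` as a product of
an arrow of `U` and one of `V`, so all these arrows are isotropic. -/
theorem mul_mem_interior_iso_of_isOpen {G : Type*} [TopologicalSpace G] [ArrowGroupoid G]
    [IsEtale G] {U V : Set G} (hU : IsOpen U) (hV : IsOpen V) {g h : G} (hg : g ∈ U) (hh : h ∈ V)
    (e : src g = rng h) (H : ∀ a ∈ U, ∀ b ∈ V, src a = rng b → rng a = src b) :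
    mul g h ∈ interior (iso G) := by
  obtain ⟨f, hf, hfe⟩ := IsEtale.isLocalHomeomorph_src (G := G) h
  have hfs : ∀ k, f k = src k := fun k => congrFun hfe.symm k
  have hs : Filter.Tendsto (src : G → G) (𝓝 (mul g h)) (𝓝 (f h)) := by
    have := (continuous_src (G := G)).tendsto (mul g h)
    rwa [src_mul _ _ e, ← hfs h] at this
  have hσ : Filter.Tendsto (fun k : G => f.symm (src k)) (𝓝 (mul g h)) (𝓝 h) :=
    (f.tendsto_symm hf).comp hs
  have hmem : ∀ᶠ k in 𝓝 (mul g h), src (f.symm (src k)) = src k := by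
    filter_upwards [hs (f.open_target.mem_nhds (f.map_source hf))] with k hk
    rw [← hfs, f.right_inv hk]
  have hq := tendsto_mul (Filter.tendsto_id (α := G)) ((IsEtale.continuous_inv.tendsto h).comp hσ)
    (by rw [src_mul _ _ e, rng_inv]) (by
      filter_upwards [hmem] with k hk
      show src k = rng (inv (f.symm (src k)))
      rw [rng_inv, hk])
  rw [mul_mul_inv e] at hq
  rw [mem_interior_iff_mem_nhds]
  filter_upwards [hmem, hσ (hV.mem_nhds hh), hq (hU.mem_nhds hg)] with k h1 h2 h3
  have e1 : src k = rng (inv (f.symm (src k))) := by rw [rng_inv, h1]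
  have h4 := H _ h3 _ h2 (by
    show src (mul k (inv (f.symm (src k)))) = _
    rw [src_mul _ _ e1, src_inv])
  have h5 : rng (mul k (inv (f.symm (src k)))) = src (f.symm (src k)) := h4
  rw [rng_mul _ _ e1, h1] at h5
  exact h5.symm

namespace SteinbergAlgebra

variable {K : Type*} [Ring K] {G : Type*} [TopologicalSpace G] [ArrowGroupoid G] [IsAmple G]

/-- The element `h ↦ a (g h)` of the group ring of the interior isotropy at the source of `g`. -/
noncomputable def restrictLeft (a : SteinbergAlgebra K G) (g : G) :
    MonoidAlgebra K (IntIsotropy (⟨src g, src_mem_units g⟩ : units G)) :=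
  .ofCoeff <| Finsupp.ofSupportFinite (fun h => a.toFun (mul g h.val)) <| by
    refine Set.Finite.subset ((a.finite_fiber_rng (rng g)).preimage (f := fun h : IntIsotropy
      (⟨src g, src_mem_units g⟩ : units G) => mul g h.val) ?_) fun h hh => ⟨hh, ?_⟩
    · intro h _ h' _ e
      have e' := congrArg (mul (inv g)) e
      simp only at e'
      rw [inv_mul_mul h.rng_eq.symm, inv_mul_mul h'.rng_eq.symm] at e'
      exact IntIsotropy.ext e'
    · exact rng_mul _ _ h.rng_eq.symm

/-- The element `h ↦ a (h g⁻¹)` of the group ring of the interior isotropy at the source of `g`. -/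
noncomputable def restrictRight (a : SteinbergAlgebra K G) (g : G) :
    MonoidAlgebra K (IntIsotropy (⟨src g, src_mem_units g⟩ : units G)) :=
  .ofCoeff <| Finsupp.ofSupportFinite (fun h => a.toFun (mul h.val (inv g))) <| by
    have hc : ∀ h : IntIsotropy (⟨src g, src_mem_units g⟩ : units G), src h.val = rng (inv g) :=
      fun h => h.src_eq.trans (rng_inv g).symm
    refine Set.Finite.subset ((a.finite_fiber_rng (src g)).preimage (f := fun h : IntIsotropy
      (⟨src g, src_mem_units g⟩ : units G) => mul h.val (inv g)) ?_) fun h hh => ⟨hh, ?_⟩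
    · intro h _ h' _ e
      have e' := congrArg (fun k => mul k (inv (inv g))) e
      simp only at e'
      rw [mul_mul_inv (hc h), mul_mul_inv (hc h')] at e'
      exact IntIsotropy.ext e'
    · exact (rng_mul _ _ (hc h)).trans h.rng_eq

theorem restrictLeft_coeff (a : SteinbergAlgebra K G) (g : G)
    (h : IntIsotropy (⟨src g, src_mem_units g⟩ : units G)) :
    (restrictLeft a g).coeff h = a.toFun (mul g h.val) := rfl

theorem restrictRight_coeff (a : SteinbergAlgebra K G) (g : G)
    (h : IntIsotropy (⟨src g, src_mem_units g⟩ : units G)) :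
    (restrictRight a g).coeff h = a.toFun (mul h.val (inv g)) := rfl

variable [T2Space G]

/-- `n` is a normalizer of the diagonal with partial inverse `n'`. -/
structure IsNormalizerPair (n n' : SteinbergAlgebra K G) : Prop where
  mul_mul : n * n' * n = n
  mul_mul' : n' * n * n' = n'
  left : IsDiagIdem (n * n')
  right : IsDiagIdem (n' * n)
  conj : ∀ d ∈ diagonal K G, n * d * n' ∈ diagonal K G
  conj' : ∀ d ∈ diagonal K G, n' * d * n ∈ diagonal K G

namespace IsNormalizerPair

variable {n n' : SteinbergAlgebra K G}

theorem symm (h : IsNormalizerPair n n') : IsNormalizerPair n' n :=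
  ⟨h.mul_mul', h.mul_mul, h.right, h.left, h.conj', h.conj⟩

/-- Moves a diagonal element across `n` by conjugation. Comparing values on the two sides turns
facts about sources into facts about ranges. -/
theorem mul_diag (h : IsNormalizerPair n n') {d : SteinbergAlgebra K G} (hd : d ∈ diagonal K G) :
    n * d = n * d * n' * n := by
  calc n * d = n * n' * n * d := by rw [h.mul_mul]
    _ = n * (n' * n * d) := by simp only [_root_.mul_assoc]
    _ = n * (d * (n' * n)) := by rw [h.right.comm d hd]
    _ = n * d * n' * n := by simp only [_root_.mul_assoc]

theorem diag_mul (h : IsNormalizerPair n n') {d : SteinbergAlgebra K G} (hd : d ∈ diagonal K G) :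
    d * n = n * (n' * d * n) := by
  calc d * n = d * (n * n') * n := by rw [_root_.mul_assoc, h.mul_mul]
    _ = n * n' * d * n := by rw [h.left.comm d hd]
    _ = n * (n' * d * n) := by simp only [_root_.mul_assoc]

theorem isDiagIdem_conj (h : IsNormalizerPair n n') {e : SteinbergAlgebra K G}
    (he : IsDiagIdem e) : IsDiagIdem (n * e * n') where
  mem_diagonal := h.conj e he.mem_diagonal
  mul_self := by
    calc n * e * n' * (n * e * n') = n * e * n' * n * (e * n') := by simp only [_root_.mul_assoc]
      _ = n * (e * e) * n' := by
        rw [← h.mul_diag he.mem_diagonal]; simp only [_root_.mul_assoc]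
      _ = n * e * n' := by rw [he.mul_self]
  comm d hd := by
    calc d * (n * e * n') = d * n * e * n' := by simp only [_root_.mul_assoc]
      _ = n * (n' * d * n * e) * n' := by rw [h.diag_mul hd]; simp only [_root_.mul_assoc]
      _ = n * e * n' * (d * (n * n')) := by
        rw [he.comm _ (h.conj' d hd)]; simp only [_root_.mul_assoc]
      _ = n * e * (n' * n * n') * d := by
        rw [h.left.comm d hd]; simp only [_root_.mul_assoc]
      _ = n * e * n' * d := by rw [h.mul_mul']

theorem mul (h : IsNormalizerPair n n') {m m' : SteinbergAlgebra K G}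
    (h' : IsNormalizerPair m m') : IsNormalizerPair (n * m) (m' * n') where
  mul_mul := by
    calc n * m * (m' * n') * (n * m) = n * ((m * m') * (n' * n)) * m := by
          simp only [_root_.mul_assoc]
      _ = n * ((n' * n) * (m * m')) * m := by rw [h.right.comm _ h'.left.mem_diagonal]
      _ = (n * n' * n) * (m * m' * m) := by simp only [_root_.mul_assoc]
      _ = n * m := by rw [h.mul_mul, h'.mul_mul]
  mul_mul' := by
    calc m' * n' * (n * m) * (m' * n') = m' * ((n' * n) * (m * m')) * n' := by
          simp only [_root_.mul_assoc]
      _ = m' * ((m * m') * (n' * n)) * n' := by rw [h.right.comm _ h'.left.mem_diagonal]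
      _ = (m' * m * m') * (n' * n * n') := by simp only [_root_.mul_assoc]
      _ = m' * n' := by rw [h.mul_mul', h'.mul_mul']
  left := by
    have := h.isDiagIdem_conj h'.left
    simpa only [_root_.mul_assoc] using this
  right := by
    have := h'.symm.isDiagIdem_conj h.right
    simpa only [_root_.mul_assoc] using this
  conj d hd := by
    have := h.conj _ (h'.conj d hd)
    simpa only [_root_.mul_assoc] using this
  conj' d hd := by
    have := h'.conj' _ (h.conj' d hd)
    simpa only [_root_.mul_assoc] using this

theorem apply_right (hK : IsIndecomposableRing K) (h : IsNormalizerPair n n') {g : G}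
    (hg : n.toFun g ≠ 0) : (n' * n).toFun (src g) = 1 := by
  refine (h.right.apply hK (src g)).resolve_left fun h0 => hg ?_
  rw [← h.mul_mul, _root_.mul_assoc, mul_diag_apply h.right.mem_diagonal, h0, mul_zero]

theorem apply_left (hK : IsIndecomposableRing K) (h : IsNormalizerPair n n') {g : G}
    (hg : n.toFun g ≠ 0) : (n * n').toFun (rng g) = 1 := by
  refine (h.left.apply hK (rng g)).resolve_left fun h0 => hg ?_
  rw [← h.mul_mul, diag_mul_apply h.left.mem_diagonal, h0, zero_mul]

theorem exists_isDiagIdem_separating {x y : G} (hx : x ∈ units G) (hxy : x ≠ y) :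
    ∃ e : SteinbergAlgebra K G, IsDiagIdem e ∧ e.toFun x = 1 ∧ e.toFun y = 0 := by
  obtain ⟨W, hW, hWc, -, hxW, hWu⟩ := exists_compact_open
    ((isOpen_units (G := G)).inter (isOpen_compl_singleton (x := y))) ⟨hx, hxy⟩
  exact ⟨ind W hW hWc 1, isDiagIdem_ind hW hWc (hWu.trans Set.inter_subset_left),
    ind_of_mem hW hWc 1 hxW, ind_of_notMem hW hWc 1 fun hy => (hWu hy).2 rfl⟩

/-- An idempotent `p` separating the two sources would have a conjugate `n p n'` equal to both 1 and
0 at the common range. -/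
theorem src_eq_of_rng_eq (hK : IsIndecomposableRing K) (h : IsNormalizerPair n n') {g k : G}
    (hg : n.toFun g ≠ 0) (hk : n.toFun k ≠ 0) (e : rng g = rng k) : src g = src k := by
  by_contra hne
  obtain ⟨p, hp, hp1, hp0⟩ := exists_isDiagIdem_separating (K := K) (src_mem_units g) hne
  have hf := h.isDiagIdem_conj hp
  have heq := h.mul_diag hp.mem_diagonal
  have h1 := congrArg (fun a => a.toFun g) heq
  have h2 := congrArg (fun a => a.toFun k) heq
  simp only [mul_diag_apply hp.mem_diagonal, diag_mul_apply hf.mem_diagonal, hp1, hp0, mul_one,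
    mul_zero] at h1 h2
  obtain h0 | h0 := hf.apply hK (rng g)
  · exact hg (by rw [h1, h0, zero_mul])
  · exact hk (by rw [← e, h0, one_mul] at h2; exact h2.symm)

theorem rng_eq_of_src_eq (hK : IsIndecomposableRing K) (h : IsNormalizerPair n n') {g k : G}
    (hg : n.toFun g ≠ 0) (hk : n.toFun k ≠ 0) (e : src g = src k) : rng g = rng k := by
  by_contra hne
  obtain ⟨p, hp, hp1, hp0⟩ := exists_isDiagIdem_separating (K := K) (rng_mem_units g) hne
  have hf := h.symm.isDiagIdem_conj hp
  have heq := h.diag_mul hp.mem_diagonal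
  have h1 := congrArg (fun a => a.toFun g) heq
  have h2 := congrArg (fun a => a.toFun k) heq
  simp only [diag_mul_apply hp.mem_diagonal, mul_diag_apply hf.mem_diagonal, hp1, hp0, one_mul,
    zero_mul] at h1 h2
  obtain h0 | h0 := hf.apply hK (src g)
  · exact hg (by rw [h1, h0, mul_zero])
  · exact hk (by rw [← e, h0, mul_one] at h2; exact h2.symm)

theorem rng_eq_src (hK : IsIndecomposableRing K) (h : IsNormalizerPair n n') {g k : G}
    (hg : n.toFun g ≠ 0) (hk : n'.toFun k ≠ 0) (e : src k = rng g) : rng k = src g := by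
  by_contra hne
  obtain ⟨p, hp, hp1, hp0⟩ := exists_isDiagIdem_separating (K := K) (src_mem_units g) (Ne.symm hne)
  have hf := h.isDiagIdem_conj hp
  have h1 := congrArg (fun a => a.toFun g) (h.mul_diag hp.mem_diagonal)
  have h2 := congrArg (fun a => a.toFun k) (h.symm.diag_mul hp.mem_diagonal)
  simp only [mul_diag_apply hp.mem_diagonal, diag_mul_apply hp.mem_diagonal,
    diag_mul_apply hf.mem_diagonal, mul_diag_apply hf.mem_diagonal, hp1, hp0, mul_one,
    zero_mul] at h1 h2
  obtain h0 | h0 := hf.apply hK (rng g)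
  · exact hg (by rw [h1, h0, zero_mul])
  · exact hk (by rw [e, h0, mul_one] at h2; exact h2.symm)

theorem src_eq_rng (hK : IsIndecomposableRing K) (h : IsNormalizerPair n n') {g k : G}
    (hg : n.toFun g ≠ 0) (hk : n'.toFun k ≠ 0) (e : rng k = src g) : src k = rng g :=
  (h.symm.rng_eq_src hK hk hg e.symm).symm

/-- Agreement of sources holds over the whole open support, so two supported arrows with the same
range differ by interior isotropy, not merely isotropy. -/
theorem inv_mul_mem_interior_iso (hK : IsIndecomposableRing K) (h : IsNormalizerPair n n')
    {g k : G} (hg : n.toFun g ≠ 0) (hk : n.toFun k ≠ 0) (e : rng g = rng k) :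
    ArrowGroupoid.mul (inv g) k ∈ interior (iso G) := by
  refine mul_mem_interior_iso_of_isOpen (n.isOpen_support.preimage IsEtale.continuous_inv)
    n.isOpen_support (g := inv g) ?_ hk (by rw [src_inv, e]) ?_
  · show n.toFun (inv (inv g)) ≠ 0
    rwa [inv_inv]
  · intro a ha b hb hab
    have := h.src_eq_of_rng_eq hK (g := inv a) ha hb (by rw [rng_inv, hab])
    rwa [src_inv] at this

theorem mul_mem_interior_iso (hK : IsIndecomposableRing K) (h : IsNormalizerPair n n')
    {g k : G} (hg : n.toFun g ≠ 0) (hk : n'.toFun k ≠ 0) (e : src k = rng g) :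
    ArrowGroupoid.mul k g ∈ interior (iso G) :=
  mul_mem_interior_iso_of_isOpen n'.isOpen_support n.isOpen_support hk hg e
    fun _ ha _ hb hab => h.rng_eq_src hK hb ha hab

end IsNormalizerPair

section Restrict

variable {n n' : SteinbergAlgebra K G}

/-- Every nonzero term of the convolution has its first factor in the coset `g H_x`, so the group
ring product sees the whole sum. -/
theorem restrictLeft_mul_restrictRight_coeff (hK : IsIndecomposableRing K)
    (hn : IsNormalizerPair n n') {g : G} (hg : n.toFun g ≠ 0)
    (q : IntIsotropy (⟨src g, src_mem_units g⟩ : units G)) :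
    (restrictLeft n g * restrictRight n' g).coeff q =
      (n * n').toFun (mul (mul g q.val) (inv g)) := by
  classical
  have hc : ∀ h : IntIsotropy (⟨src g, src_mem_units g⟩ : units G), src g = rng h.val :=
    fun h => h.rng_eq.symm
  have hc' : ∀ h : IntIsotropy (⟨src g, src_mem_units g⟩ : units G), src h.val = rng (inv g) :=
    fun h => h.src_eq.trans (rng_inv g).symm
  have hgq : src (mul g q.val) = rng (inv g) := (src_mul _ _ (hc q)).trans (hc' q)
  have hinj : Set.InjOn (fun h : IntIsotropy (⟨src g, src_mem_units g⟩ : units G) => mul g h.val)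
      ((restrictLeft n g).coeff.support : Set _) := by
    intro h _ h' _ e
    have e' := congrArg (mul (inv g)) e
    simp only at e'
    rw [inv_mul_mul (hc h), inv_mul_mul (hc h')] at e'
    exact IntIsotropy.ext e'
  rw [MonoidAlgebra.coeff_mul_apply_left, Finsupp.sum, mul_toFun, conv_eq_sum
    ((restrictLeft n g).coeff.support.image fun h => mul g h.val), Finset.sum_image hinj]
  · refine Finset.sum_congr rfl fun h _ => ?_
    rw [restrictLeft_coeff, restrictRight_coeff]
    congr 2
    show mul (mul (inv h.val) q.val) (inv g) = _
    rw [inv_mul_rev (hc h), mul_assoc (inv h.val) (inv g) _ (by rw [src_inv, ← hc h, rng_inv])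
      (by rw [src_inv, rng_mul _ _ hgq, rng_mul _ _ (hc q)]),
      mul_assoc g q.val _ (hc q) (hc' q), inv_mul_mul (by rw [rng_mul _ _ (hc' q), ← hc q]),
      mul_assoc _ _ _ (by rw [src_inv, ← hc h]; exact hc q) (hc' q)]
  · intro k hk
    obtain ⟨h, _, rfl⟩ := Finset.mem_image.1 hk
    rw [rng_mul _ _ hgq, rng_mul _ _ (hc h), rng_mul _ _ (hc q)]
  · intro k hk hne
    rw [rng_mul _ _ hgq, rng_mul _ _ (hc q)] at hk
    have hnk := left_ne_zero_of_mul hne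
    have hs := hn.src_eq_of_rng_eq hK hnk hg hk
    have e : src (inv g) = rng k := by rw [src_inv, hk]
    refine Finset.mem_image.2 ⟨⟨mul (inv g) k, hn.inv_mul_mem_interior_iso hK hg hnk hk.symm,
      (src_mul _ _ e).trans hs, (rng_mul _ _ e).trans (rng_inv g)⟩, ?_, mul_inv_mul_self hk.symm⟩
    rw [Finsupp.mem_support_iff, restrictLeft_coeff, mul_inv_mul_self hk.symm]
    exact hnk

theorem restrictRight_mul_restrictLeft_coeff (hK : IsIndecomposableRing K)
    (hn : IsNormalizerPair n n') {g : G} (hg : n.toFun g ≠ 0)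
    (q : IntIsotropy (⟨src g, src_mem_units g⟩ : units G)) :
    (restrictRight n' g * restrictLeft n g).coeff q = (n' * n).toFun q.val := by
  classical
  have hc : ∀ h : IntIsotropy (⟨src g, src_mem_units g⟩ : units G), src g = rng h.val :=
    fun h => h.rng_eq.symm
  have hc' : ∀ h : IntIsotropy (⟨src g, src_mem_units g⟩ : units G), src h.val = rng (inv g) :=
    fun h => h.src_eq.trans (rng_inv g).symm
  have hinj : Set.InjOn (fun h : IntIsotropy (⟨src g, src_mem_units g⟩ : units G) =>
      mul h.val (inv g)) ((restrictRight n' g).coeff.support : Set _) := by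
    intro h _ h' _ e
    have e' := congrArg (fun k => mul k (inv (inv g))) e
    simp only at e'
    rw [mul_mul_inv (hc' h), mul_mul_inv (hc' h')] at e'
    exact IntIsotropy.ext e'
  rw [MonoidAlgebra.coeff_mul_apply_left, Finsupp.sum, mul_toFun, conv_eq_sum
    ((restrictRight n' g).coeff.support.image fun h => mul h.val (inv g)), Finset.sum_image hinj]
  · refine Finset.sum_congr rfl fun h _ => ?_
    rw [restrictLeft_coeff, restrictRight_coeff]
    congr 2
    show mul g (mul (inv h.val) q.val) = _
    rw [inv_mul_rev (hc' h), inv_inv, mul_assoc _ _ _ (by rw [rng_inv]; exact h.src_eq.symm)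
      (by rw [src_inv, ← hc h]; exact hc q)]
  · intro k hk
    obtain ⟨h, _, rfl⟩ := Finset.mem_image.1 hk
    rw [rng_mul _ _ (hc' h), ← hc h]
    exact hc q
  · intro k hk hne
    rw [← hc q] at hk
    have hnk := left_ne_zero_of_mul hne
    have hs := hn.src_eq_rng hK hg hnk hk
    have e : mul (mul k g) (inv g) = k := mul_mul_inv hs
    refine Finset.mem_image.2 ⟨⟨mul k g, hn.mul_mem_interior_iso hK hg hnk hs,
      src_mul _ _ hs, (rng_mul _ _ hs).trans hk⟩, ?_, e⟩
    rw [Finsupp.mem_support_iff, restrictRight_coeff, e]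
    exact hnk

end Restrict

end SteinbergAlgebra

/-! ### Unit supports of normalizers -/

namespace SteinbergAlgebra

variable {K : Type*} [Ring K] {G : Type*} [TopologicalSpace G]

/-- The set of arrows where `n` takes a unit value. -/
def unitSupport (n : SteinbergAlgebra K G) : Set G := {g | IsUnit (n.toFun g)}

theorem ne_zero_of_mem_unitSupport [Nontrivial K] {n : SteinbergAlgebra K G} {g : G}
    (hg : g ∈ unitSupport n) : n.toFun g ≠ 0 := IsUnit.ne_zero hg

theorem isOpen_unitSupport (n : SteinbergAlgebra K G) : IsOpen (unitSupport n) :=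
  n.isLocallyConstant {c | IsUnit c}

theorem isCompact_unitSupport [Nontrivial K] (n : SteinbergAlgebra K G) :
    IsCompact (unitSupport n) :=
  n.isCompact_support.of_isClosed_subset
    (isOpen_compl_iff.1 (n.isLocallyConstant {c | ¬ IsUnit c}))
    fun _ hg => ne_zero_of_mem_unitSupport hg

theorem unitSupport_ind [Nontrivial K] [T2Space G] {B : Set G} (hBo : IsOpen B)
    (hBc : IsCompact B) :
    unitSupport (ind B hBo hBc (1 : K)) = B := by
  ext g
  refine ⟨fun hg => support_ind_subset hBo hBc _ (ne_zero_of_mem_unitSupport hg), fun hg => ?_⟩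
  show IsUnit _
  rw [ind_of_mem hBo hBc _ hg]
  exact isUnit_one

variable [ArrowGroupoid G] [IsAmple G] [T2Space G]

namespace IsNormalizerPair

variable {n n' : SteinbergAlgebra K G}

/-- `n n'` is diagonal with value 1 at `rng g`, and the conjugate of `q` by `g` is a unit only for
`q = 1`. -/
theorem restrictLeft_mul_restrictRight (hK : IsIndecomposableRing K)
    (hn : IsNormalizerPair n n') {g : G} (hg : n.toFun g ≠ 0) :
    restrictLeft n g * restrictRight n' g = 1 := by
  classical
  refine MonoidAlgebra.ext (Finsupp.ext fun q => ?_)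
  rw [restrictLeft_mul_restrictRight_coeff hK hn hg]
  have hc : src g = rng q.val := q.rng_eq.symm
  have hgq : src (ArrowGroupoid.mul g q.val) = rng (inv g) := by
    rw [src_mul _ _ hc, rng_inv]; exact q.src_eq
  by_cases hq : q = 1
  · subst hq
    have h1 : ArrowGroupoid.mul g
        (1 : IntIsotropy (⟨src g, src_mem_units g⟩ : units G)).val = g := mul_src g
    rw [h1, mul_inv, hn.apply_left hK hg, MonoidAlgebra.coeff_one_one]
  · rw [MonoidAlgebra.one_def, MonoidAlgebra.coeff_single, Finsupp.single_eq_of_ne hq]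
    refine apply_eq_zero hn.left.mem_diagonal fun hu => hq (IntIsotropy.ext ?_)
    show q.val = src g
    have h1 := rng_eq_self_of_mem_units hu
    rw [rng_mul _ _ hgq, rng_mul _ _ hc] at h1
    have h2 := congrArg (fun k => ArrowGroupoid.mul k g) h1
    simp only [rng_mul_self] at h2
    have h3 := mul_inv_mul (k := ArrowGroupoid.mul g q.val) (h := g) (by
      rw [src_mul _ _ hc]; exact q.src_eq)
    exact eq_src_of_mul_eq hc (h3.symm.trans h2.symm)

theorem restrictRight_mul_restrictLeft (hK : IsIndecomposableRing K)
    (hn : IsNormalizerPair n n') {g : G} (hg : n.toFun g ≠ 0) :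
    restrictRight n' g * restrictLeft n g = 1 := by
  classical
  refine MonoidAlgebra.ext (Finsupp.ext fun q => ?_)
  rw [restrictRight_mul_restrictLeft_coeff hK hn hg]
  by_cases hq : q = 1
  · subst hq
    rw [MonoidAlgebra.coeff_one_one]
    exact hn.apply_right hK hg
  · rw [MonoidAlgebra.one_def, MonoidAlgebra.coeff_single, Finsupp.single_eq_of_ne hq]
    refine apply_eq_zero hn.right.mem_diagonal fun hu => hq (IntIsotropy.ext ?_)
    exact (src_eq_self_of_mem_units hu).symm.trans q.src_eq

theorem exists_mem_unitSupport (hK : IsIndecomposableRing K) (hG : HasMonomialUnits K G)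
    (hn : IsNormalizerPair n n') {g₀ : G} (hg₀ : n.toFun g₀ ≠ 0) :
    ∃ g ∈ unitSupport n, src g = src g₀ ∧ rng g = rng g₀ ∧ ∀ k, src k = src g → k ≠ g →
      ∃ ζ ∈ Subring.center K, IsNilpotent ζ ∧ n.toFun k = ζ * n.toFun g := by
  have hc : ∀ h : IntIsotropy (⟨src g₀, src_mem_units g₀⟩ : units G), src g₀ = rng h.val :=
    fun h => h.rng_eq.symm
  have hc' : ∀ h : IntIsotropy (⟨src g₀, src_mem_units g₀⟩ : units G), src h.val = rng (inv g₀) :=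
    fun h => h.src_eq.trans (rng_inv g₀).symm
  obtain ⟨h, hu, hζ⟩ := hG _ _ _ (hn.restrictLeft_mul_restrictRight hK hg₀)
    (hn.restrictRight_mul_restrictLeft hK hg₀) (by
      intro k
      obtain ⟨W, hW, hWc, -, hxW, hWu⟩ :=
        exists_compact_open (isOpen_units (G := G)) (src_mem_units g₀)
      have hd := ind_mem_diagonal hW hWc k hWu
      -- Conjugating a diagonal function with value `k` at the source yields the coefficient by
      -- which `k` passes to the other side.
      refine ⟨(n * ind W hW hWc k * n').toFun (rng g₀), fun h => ?_⟩
      have h1 := congrArg (fun a => a.toFun (ArrowGroupoid.mul g₀ h.val)) (hn.mul_diag hd)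
      have hs : src (ArrowGroupoid.mul g₀ h.val) = src g₀ :=
        (src_mul _ _ (hc h)).trans h.src_eq
      simp only [mul_diag_apply hd, diag_mul_apply (hn.conj _ hd), hs, rng_mul _ _ (hc h),
        ind_of_mem hW hWc k hxW] at h1
      exact h1) (by
      intro k
      obtain ⟨W, hW, hWc, -, hxW, hWu⟩ :=
        exists_compact_open (isOpen_units (G := G)) (rng_mem_units g₀)
      have hd := ind_mem_diagonal hW hWc k hWu
      refine ⟨(n' * ind W hW hWc k * n).toFun (src g₀), fun h => ?_⟩
      have h1 := congrArg (fun a => a.toFun (ArrowGroupoid.mul h.val (inv g₀)))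
        (hn.symm.mul_diag hd)
      have hr : rng (ArrowGroupoid.mul h.val (inv g₀)) = src g₀ :=
        (rng_mul _ _ (hc' h)).trans h.rng_eq
      simp only [mul_diag_apply hd, diag_mul_apply (hn.symm.conj _ hd), hr, src_mul _ _ (hc' h),
        src_inv, ind_of_mem hW hWc k hxW] at h1
      exact h1)
  refine ⟨ArrowGroupoid.mul g₀ h.val, hu, (src_mul _ _ (hc h)).trans h.src_eq,
    rng_mul _ _ (hc h), fun k hk hne => ?_⟩
  rw [src_mul _ _ (hc h)] at hk
  replace hk : src k = src g₀ := hk.trans h.src_eq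
  by_cases hk0 : n.toFun k = 0
  · exact ⟨0, Subring.zero_mem _, IsNilpotent.zero, by rw [hk0, zero_mul]⟩
  have hr := hn.rng_eq_of_src_eq hK hk0 hg₀ hk
  have e : src (inv g₀) = rng k := by rw [src_inv, hr]
  have hkk := mul_inv_mul_self hr.symm
  obtain ⟨ζ, h1, h2, h3⟩ := hζ ⟨ArrowGroupoid.mul (inv g₀) k,
    hn.inv_mul_mem_interior_iso hK hg₀ hk0 hr.symm, (src_mul _ _ e).trans hk,
    (rng_mul _ _ e).trans (rng_inv g₀)⟩ (by
      rintro rfl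
      exact hne hkk.symm)
  refine ⟨ζ, h1, h2, ?_⟩
  rw [restrictLeft_coeff, restrictLeft_coeff, hkk] at h3
  exact h3

/-- Within a source fibre every other value is a nilpotent central multiple of the distinguished
one, and over a nontrivial ring it cannot be a unit. -/
theorem eq_of_mem_unitSupport (hK : IsIndecomposableRing K) (hG : HasMonomialUnits K G)
    (hn : IsNormalizerPair n n') {g k : G} (hg : g ∈ unitSupport n) (hk : k ∈ unitSupport n)
    (e : src g = src k) : g = k := by
  have := hK.1
  obtain ⟨g₁, h1, h2, -, h3⟩ := hn.exists_mem_unitSupport hK hG (ne_zero_of_mem_unitSupport hg)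
  have key : ∀ k ∈ unitSupport n, src k = src g₁ → k = g₁ := by
    intro k hk hs
    by_contra hne
    obtain ⟨ζ, -, h5, h6⟩ := h3 k hs hne
    have hk' : IsUnit (n.toFun k) := hk
    obtain ⟨u, hu⟩ : IsUnit (n.toFun g₁) := h1
    rw [h6, ← hu, Units.isUnit_mul_units] at hk'
    exact h5.not_isUnit hk'
  rw [key g hg h2.symm, key k hk (e.symm.trans h2.symm)]

theorem isBisection_unitSupport (hK : IsIndecomposableRing K) (hG : HasMonomialUnits K G)
    (hn : IsNormalizerPair n n') : IsBisection (unitSupport n) := by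
  have := hK.1
  refine ⟨fun g hg k hk e => hn.eq_of_mem_unitSupport hK hG hg hk e, fun g hg k hk e => ?_⟩
  exact hn.eq_of_mem_unitSupport hK hG hg hk (hn.src_eq_of_rng_eq hK
    (ne_zero_of_mem_unitSupport hg) (ne_zero_of_mem_unitSupport hk) e)

theorem exists_eq_mul (hK : IsIndecomposableRing K) (hG : HasMonomialUnits K G)
    (hn : IsNormalizerPair n n') {g k : G} (hg : g ∈ unitSupport n) (e : src k = src g)
    (hne : k ≠ g) : ∃ ζ ∈ Subring.center K, IsNilpotent ζ ∧ n.toFun k = ζ * n.toFun g := by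
  have := hK.1
  obtain ⟨g₁, h1, h2, -, h3⟩ := hn.exists_mem_unitSupport hK hG (ne_zero_of_mem_unitSupport hg)
  obtain rfl := hn.eq_of_mem_unitSupport hK hG h1 hg h2
  exact h3 k e hne

end IsNormalizerPair

end SteinbergAlgebra

end ArrowGroupoid

/-! ### Products and disjointness of unit supports -/

theorem exists_sum_eq_nilpotent_mul {K ι : Type*} [Ring K] (s : Finset ι) (f : ι → K) (c : K)
    (h : ∀ i ∈ s, ∃ ζ ∈ Subring.center K, IsNilpotent ζ ∧ f i = ζ * c) :
    ∃ ζ ∈ Subring.center K, IsNilpotent ζ ∧ ∑ i ∈ s, f i = ζ * c := by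
  classical
  induction s using Finset.induction_on with
  | empty => exact ⟨0, Subring.zero_mem _, IsNilpotent.zero, by simp⟩
  | insert a s ha ih =>
    obtain ⟨ζ, h1, h2, h3⟩ := ih fun i hi => h i (Finset.mem_insert_of_mem hi)
    obtain ⟨ξ, k1, k2, k3⟩ := h a (Finset.mem_insert_self a s)
    refine ⟨ξ + ζ, Subring.add_mem _ k1 h1, ?_, ?_⟩
    · exact Commute.isNilpotent_add (Subring.mem_center_iff.1 h1 ξ) k2 h2
    · rw [Finset.sum_insert ha, k3, h3, add_mul]

/-- For each new nilpotent element, replace `c` by its last nonzero multiple by a power of that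
element; centrality keeps the earlier annihilations. This `c` later erases the nilpotent tails of
normalizers. -/
theorem exists_ne_zero_forall_mul_eq_zero {K : Type*} [Ring K] [Nontrivial K] (Z : Finset K)
    (h : ∀ ζ ∈ Z, ζ ∈ Subring.center K ∧ IsNilpotent ζ) :
    ∃ c : K, c ≠ 0 ∧ ∀ ζ ∈ Z, ζ * c = 0 := by
  classical
  induction Z using Finset.induction_on with
  | empty => exact ⟨1, one_ne_zero, by simp⟩
  | insert a s ha ih =>
    obtain ⟨c, hc, hs⟩ := ih fun ζ hζ => h ζ (Finset.mem_insert_of_mem hζ)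
    obtain ⟨hac, N, hN⟩ := h a (Finset.mem_insert_self a s)
    have hex : ∃ j, a ^ j * c = 0 := ⟨N, by rw [hN, zero_mul]⟩
    have h0 : Nat.find hex ≠ 0 := fun h0 => by
      have := Nat.find_spec hex
      rw [h0, pow_zero, one_mul] at this
      exact hc this
    obtain ⟨j, hj⟩ := Nat.exists_eq_succ_of_ne_zero h0
    refine ⟨a ^ j * c, Nat.find_min hex (by omega), fun ζ hζ => ?_⟩
    rw [Finset.mem_insert] at hζ
    obtain rfl | hζ := hζ
    · rw [← mul_assoc, ← pow_succ', ← Nat.succ_eq_add_one, ← hj]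
      exact Nat.find_spec hex
    · rw [← mul_assoc, Subring.mem_center_iff.1 (Subring.pow_mem _ hac j), mul_assoc, hs ζ hζ,
        mul_zero]

namespace ArrowGroupoid

namespace SteinbergAlgebra

variable {K : Type*} [Ring K] {G : Type*} [TopologicalSpace G] [ArrowGroupoid G]
  [IsAmple G] [T2Space G]

namespace IsNormalizerPair

variable {n n' m m' : SteinbergAlgebra K G}

/-- The term of the pair `(g, h)` is a unit. Every other term is a nilpotent central multiple of it,
so the sum is that unit times `1 + ζ` with `ζ` nilpotent. -/
theorem mul_mem_unitSupport (hK : IsIndecomposableRing K) (hG : HasMonomialUnits K G)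
    (hn : IsNormalizerPair n n') (hm : IsNormalizerPair m m') {g h : G} (hg : g ∈ unitSupport n)
    (hh : h ∈ unitSupport m) (e : src g = rng h) :
    ArrowGroupoid.mul g h ∈ unitSupport (n * m) := by
  classical
  have := hK.1
  show IsUnit ((n * m).toFun _)
  have hF : ∀ k, k ∈ (n.finite_fiber_rng (rng g)).toFinset ↔ n.toFun k ≠ 0 ∧ rng k = rng g := by
    intro k; simp
  rw [mul_toFun, conv_eq_sum (n.finite_fiber_rng (rng g)).toFinset
    (fun k hk => by rw [rng_mul _ _ e, ((hF k).1 hk).2])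
    (fun k hk hne => (hF k).2 ⟨left_ne_zero_of_mul hne, by rw [hk, rng_mul _ _ e]⟩),
    ← Finset.add_sum_erase _ _ ((hF g).2 ⟨ne_zero_of_mem_unitSupport hg, rfl⟩), inv_mul_mul e]
  obtain ⟨ζ, h1, h2, h3⟩ := exists_sum_eq_nilpotent_mul
    ((n.finite_fiber_rng (rng g)).toFinset.erase g)
    (fun k => n.toFun k * m.toFun (ArrowGroupoid.mul (inv k) (ArrowGroupoid.mul g h)))
    (n.toFun g * m.toFun h) (by
      intro k hk
      obtain ⟨hkg, hk⟩ := Finset.mem_erase.1 hk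
      obtain ⟨hk0, hkr⟩ := (hF k).1 hk
      have hks := hn.src_eq_of_rng_eq hK hk0 (ne_zero_of_mem_unitSupport hg) hkr
      have e1 : src (inv k) = rng (ArrowGroupoid.mul g h) := by
        rw [src_inv, rng_mul _ _ e, hkr]
      have hkk : rng k = rng (ArrowGroupoid.mul g h) := by rw [rng_mul _ _ e, hkr]
      obtain ⟨ζ, h1, h2, h3⟩ := hn.exists_eq_mul hK hG hg hks hkg
      obtain ⟨ξ, k1, k2, k3⟩ := hm.exists_eq_mul hK hG hh
        (k := ArrowGroupoid.mul (inv k) (ArrowGroupoid.mul g h))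
        (by rw [src_mul _ _ e1, src_mul _ _ e]) (by
          intro heq
          have h4 := mul_inv_mul_self hkk
          rw [heq] at h4
          have h5 := mul_mul_inv (hks.trans e)
          rw [h4, mul_mul_inv e] at h5
          exact hkg h5.symm)
      refine ⟨ζ * ξ, Subring.mul_mem _ h1 k1,
        Commute.isNilpotent_mul_right (Subring.mem_center_iff.1 k1 ζ) h2, ?_⟩
      rw [h3, k3, _root_.mul_assoc, ← _root_.mul_assoc (n.toFun g),
        Subring.mem_center_iff.1 k1]
      simp only [_root_.mul_assoc])
  rw [h3, ← one_add_mul]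
  exact h2.isUnit_one_add.mul (IsUnit.mul hg hh)

/-- A nonzero term over `k` provides unit values of `n` and `m` in the right fibres. Their product
lies in the unit support with the same source as `k`, hence equals `k`. -/
theorem mem_unitSupport_mul (hK : IsIndecomposableRing K) (hG : HasMonomialUnits K G)
    (hn : IsNormalizerPair n n') (hm : IsNormalizerPair m m') {k : G} :
    k ∈ unitSupport (n * m) ↔ ∃ g ∈ unitSupport n, ∃ h ∈ unitSupport m,
      src g = rng h ∧ ArrowGroupoid.mul g h = k := by
  have := hK.1
  refine ⟨fun hk => ?_, ?_⟩
  · obtain ⟨a, ha, h1, h2⟩ := exists_of_conv_ne_zero (ne_zero_of_mem_unitSupport hk)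
    obtain ⟨g, hg, hgs, -⟩ := hn.exists_mem_unitSupport hK hG h1
    obtain ⟨h, hh, hhs, hhr, -⟩ := hm.exists_mem_unitSupport hK hG h2
    have e1 : src (inv a) = rng k := by rw [src_inv, ha]
    rw [src_mul _ _ e1] at hhs
    rw [rng_mul _ _ e1, rng_inv] at hhr
    have e : src g = rng h := hgs.trans hhr.symm
    refine ⟨g, hg, h, hh, e, ?_⟩
    exact (hn.mul hm).eq_of_mem_unitSupport hK hG (hn.mul_mem_unitSupport hK hG hm hg hh e) hk
      ((src_mul _ _ e).trans hhs)
  · rintro ⟨g, hg, h, hh, e, rfl⟩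
    exact hn.mul_mem_unitSupport hK hG hm hg hh e

/-- Cutting down to sources of `B` leaves the value `w` on `B` and nilpotent multiples of `w` off
it; the factor `w⁻¹ c` normalises the former to `c` and kills the latter. -/
theorem mul_ind_eq (hK : IsIndecomposableRing K) (hG : HasMonomialUnits K G)
    (hn : IsNormalizerPair n n') {B : Set G} (hB : IsOpen B) (hBc : IsCompact B)
    (hBb : IsBisection B) {w : Kˣ} (hw : ∀ b ∈ B, n.toFun b = w) {c : K}
    (hc : ∀ k, n.toFun k * (w⁻¹ : Kˣ) ∈ Subring.center K →
      IsNilpotent (n.toFun k * (w⁻¹ : Kˣ)) → n.toFun k * (w⁻¹ : Kˣ) * c = 0)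
    (hU : IsOpen (src '' B)) (hUc : IsCompact (src '' B)) :
    n * ind (src '' B) hU hUc ((w⁻¹ : Kˣ) * c) = ind B hB hBc c := by
  have hd : ind (src '' B) hU hUc ((w⁻¹ : Kˣ) * c) ∈ diagonal K G :=
    ind_mem_diagonal hU hUc _ (by rintro _ ⟨b, -, rfl⟩; exact src_mem_units b)
  refine SteinbergAlgebra.ext (funext fun a => ?_)
  rw [mul_diag_apply hd]
  by_cases ha : src a ∈ src '' B
  · rw [ind_of_mem hU hUc _ ha]
    obtain ⟨b, hb, hba⟩ := ha
    have hbu : b ∈ unitSupport n := by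
      show IsUnit _
      rw [hw b hb]
      exact w.isUnit
    by_cases hab : a = b
    · rw [hab, ind_of_mem hB hBc _ hb, hw b hb, Units.mul_inv_cancel_left]
    · rw [ind_of_notMem hB hBc _ fun haB => hab (hBb.1 haB hb hba.symm), ← _root_.mul_assoc]
      obtain ⟨ζ, h1, h2, h3⟩ := hn.exists_eq_mul hK hG hbu hba.symm hab
      rw [hw b hb] at h3
      have h4 : n.toFun a * (w⁻¹ : Kˣ) = ζ := by rw [h3, Units.mul_inv_cancel_right]
      exact hc a (h4 ▸ h1) (h4 ▸ h2)
  · rw [ind_of_notMem hU hUc _ ha, mul_zero,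
      ind_of_notMem hB hBc _ fun haB => ha (Set.mem_image_of_mem _ haB)]

/-- The point is that the right side is purely multiplicative: the last clause says `n * c` is
nonzero, since zero is the element absorbing every right factor. -/
theorem not_disjoint_iff (hK : IsIndecomposableRing K) (hG : HasMonomialUnits K G)
    (hn : IsNormalizerPair n n') (hm : IsNormalizerPair m m') :
    ¬ Disjoint (unitSupport n) (unitSupport m) ↔ ∃ c ∈ diagonal K G, ∃ d ∈ diagonal K G,
      n * c = m * d ∧ ∃ b, n * c * b ≠ n * c := by
  classical
  have := hK.1
  rw [Set.not_disjoint_iff]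
  constructor
  · rintro ⟨g, ⟨w, hw⟩, ⟨t, ht⟩⟩
    -- Elements of the algebra take finitely many values, so a single `c` annihilates the nilpotent
    -- ratios of both normalizers, and both cut down to the same function `c` on `B`.
    have hfn := (n.finite_range.image fun x : K => x * ((w⁻¹ : Kˣ) : K)).union
      (m.finite_range.image fun x : K => x * ((t⁻¹ : Kˣ) : K))
    obtain ⟨c, hc0, hc⟩ := exists_ne_zero_forall_mul_eq_zero
      (hfn.toFinset.filter fun ζ => ζ ∈ Subring.center K ∧ IsNilpotent ζ)
      fun ζ hζ => (Finset.mem_filter.1 hζ).2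
    obtain ⟨B, hB, hBc, hBb, hgB, hBs⟩ := exists_compact_open
      ((n.isLocallyConstant.isOpen_fiber w).inter (m.isLocallyConstant.isOpen_fiber t))
      (x := g) ⟨hw.symm, ht.symm⟩
    have hU : IsOpen (src '' B) := IsEtale.isLocalHomeomorph_src.isOpenMap _ hB
    have hUc : IsCompact (src '' B) := hBc.image continuous_src
    have hUu : src '' B ⊆ units G := by rintro _ ⟨b, -, rfl⟩; exact src_mem_units b
    have e1 := hn.mul_ind_eq hK hG hB hBc hBb (w := w) (c := c) (fun b hb => (hBs hb).1)
      (fun k h1 h2 => hc _ (Finset.mem_filter.2 ⟨hfn.mem_toFinset.2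
        (Or.inl ⟨_, ⟨k, rfl⟩, rfl⟩), h1, h2⟩)) hU hUc
    have e2 := hm.mul_ind_eq hK hG hB hBc hBb (w := t) (c := c) (fun b hb => (hBs hb).2)
      (fun k h1 h2 => hc _ (Finset.mem_filter.2 ⟨hfn.mem_toFinset.2
        (Or.inr ⟨_, ⟨k, rfl⟩, rfl⟩), h1, h2⟩)) hU hUc
    refine ⟨_, ind_mem_diagonal hU hUc _ hUu, _, ind_mem_diagonal hU hUc _ hUu, e1.trans e2.symm,
      ind ∅ isOpen_empty isCompact_empty 0, fun h => hc0 ?_⟩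
    rw [e1] at h
    have h' := congrArg (fun a => a.toFun g) h
    simp only [ind_of_mem hB hBc _ hgB, mul_diag_apply (ind_mem_diagonal isOpen_empty
      isCompact_empty (0 : K) (Set.empty_subset (units G))),
      ind_of_notMem isOpen_empty isCompact_empty (0 : K) (Set.notMem_empty (src g)),
      mul_zero] at h'
    exact h'.symm
  · rintro ⟨c, hc, d, hd, hcd, b, hb⟩
    obtain ⟨k, hk⟩ : ∃ k, (n * c).toFun k ≠ 0 := by
      by_contra hcon
      push Not at hcon
      apply hb
      refine SteinbergAlgebra.ext (funext fun k => ?_)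
      rw [hcon k]
      by_contra hne
      obtain ⟨a, -, h1, -⟩ := exists_of_conv_ne_zero hne
      exact h1 (hcon a)
    have hval : ∀ a, src a = src k → n.toFun a * c.toFun (src k) = m.toFun a * d.toFun (src k) := by
      intro a ha
      have := congrArg (fun x => x.toFun a) hcd
      simpa only [mul_diag_apply hc, mul_diag_apply hd, ha] using this
    rw [mul_diag_apply hc] at hk
    have hk' := hk
    rw [hval k rfl] at hk'
    obtain ⟨g, hg, hgs, -⟩ := hn.exists_mem_unitSupport hK hG (left_ne_zero_of_mul hk)
    obtain ⟨h, hh, hhs, -⟩ := hm.exists_mem_unitSupport hK hG (left_ne_zero_of_mul hk')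
    by_cases hgh : g = h
    · exact ⟨g, hg, hgh ▸ hh⟩
    exfalso
    obtain ⟨ζ, h1, h2, h3⟩ := hm.exists_eq_mul hK hG hh (hgs.trans hhs.symm) hgh
    obtain ⟨ξ, k1, k2, k3⟩ := hn.exists_eq_mul hK hG hg (hhs.trans hgs.symm) (Ne.symm hgh)
    -- Going from `g` to `h` through `m` and back through `n` multiplies by a nilpotent, so the
    -- value vanishes, and with it the value at `k`.
    have key : n.toFun g * c.toFun (src k) = ζ * ξ * (n.toFun g * c.toFun (src k)) := by
      calc n.toFun g * c.toFun (src k) = ζ * (m.toFun h * d.toFun (src k)) := by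
            rw [hval g hgs, h3, _root_.mul_assoc]
        _ = ζ * ξ * (n.toFun g * c.toFun (src k)) := by
            rw [← hval h hhs, k3]; simp only [_root_.mul_assoc]
    have hnil : IsNilpotent (ζ * ξ) :=
      Commute.isNilpotent_mul_right (Subring.mem_center_iff.1 k1 ζ) h2
    have hzero : n.toFun g * c.toFun (src k) = 0 := by
      rw [← hnil.isUnit_one_sub.mul_right_eq_zero, sub_mul, one_mul, ← key, sub_self]
    apply hk
    by_cases hkg : k = g
    · rw [← hkg] at hzero; exact hzero
    · obtain ⟨η, -, -, h6⟩ := hn.exists_eq_mul hK hG hg hgs.symm hkg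
      rw [h6, _root_.mul_assoc, hzero, mul_zero]

end IsNormalizerPair

/-! ### Indicators of compact open bisections as normalizers -/

section Bisection

theorem mul_mem_diagonal_of_isBisection {B B' : Set G} (hB : IsBisection B)
    (hB' : ∀ g ∈ B', inv g ∈ B) {a b : SteinbergAlgebra K G} (ha : Function.support a.toFun ⊆ B)
    (hb : Function.support b.toFun ⊆ B') : a * b ∈ diagonal K G := by
  intro g hg
  obtain ⟨k, hk, h1, h2⟩ := exists_of_conv_ne_zero hg
  have e : src (inv k) = rng g := by rw [src_inv, hk]
  have e' : src (inv g) = rng k := by rw [src_inv, hk]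
  have h3 := hB' _ (hb h2)
  rw [inv_mul_rev e, inv_inv] at h3
  have h4 := hB.1 h3 (ha h1) (src_mul _ _ e')
  have h5 := eq_rng_of_mul_eq e' h4
  have h6 : inv g ∈ units G := h5 ▸ rng_mem_units k
  rw [← inv_inv g, inv_eq_self_of_mem_units h6]
  exact h6

variable {B B' : Set G} (hBo : IsOpen B) (hBc : IsCompact B) (hBo' : IsOpen B')
  (hBc' : IsCompact B')

theorem ind_mul_ind (hB : IsBisection B) (hB' : ∀ g, g ∈ B' ↔ inv g ∈ B) :
    IsDiagIdem (ind B hBo hBc (1 : K) * ind B' hBo' hBc' 1) ∧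
    ind B hBo hBc (1 : K) * ind B' hBo' hBc' 1 * ind B hBo hBc 1 = ind B hBo hBc 1 ∧
    ∀ d ∈ diagonal K G, ind B hBo hBc (1 : K) * d * ind B' hBo' hBc' 1 ∈ diagonal K G := by
  have hD : ind B hBo hBc (1 : K) * ind B' hBo' hBc' 1 ∈ diagonal K G :=
    mul_mem_diagonal_of_isBisection hB (fun g hg => (hB' g).1 hg) (support_ind_subset _ _ _)
      (support_ind_subset _ _ _)
  have hval : ∀ b ∈ B, ∀ g, rng b = rng g → (ind B hBo hBc (1 : K) * ind B' hBo' hBc' 1).toFun g =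
      (ind B' hBo' hBc' (1 : K)).toFun (mul (inv b) g) := by
    intro b hb g e
    rw [mul_toFun, conv_eq_single b e, ind_of_mem hBo hBc _ hb, one_mul]
    intro k hk hne
    rw [ind_of_notMem hBo hBc _ fun hkB => hne (hB.2 hkB hb (hk.trans e.symm)), zero_mul]
  refine ⟨isDiagIdem_of_apply hD fun g => ?_, ?_, fun d hd => ?_⟩
  · by_cases h0 : (ind B hBo hBc (1 : K) * ind B' hBo' hBc' 1).toFun g = 0
    · exact Or.inl h0
    · obtain ⟨k, hk, h1, h2⟩ := exists_of_conv_ne_zero h0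
      right
      rw [hval k (support_ind_subset hBo hBc _ h1) g hk,
        ind_of_mem hBo' hBc' _ (support_ind_subset hBo' hBc' _ h2)]
  · refine SteinbergAlgebra.ext (funext fun g => ?_)
    rw [diag_mul_apply hD]
    by_cases hg : g ∈ B
    · have e : mul (inv g) (rng g) = inv g := by rw [← src_inv, mul_src]
      rw [hval g hg _ (rng_rng g).symm, e, ind_of_mem hBo' hBc' _ ((hB' _).2 (by rwa [inv_inv])),
        one_mul]
    · rw [ind_of_notMem hBo hBc _ hg, mul_zero]
  · refine mul_mem_diagonal_of_isBisection hB (fun g hg => (hB' g).1 hg) ?_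
      (support_ind_subset _ _ _)
    intro g hg
    rw [Function.mem_support, mul_diag_apply hd] at hg
    exact support_ind_subset hBo hBc _ (left_ne_zero_of_mul hg)

/-- The partial inverse is the indicator of the inverse bisection. -/
theorem exists_isNormalizerPair_ind (hB : IsBisection B) :
    ∃ n', IsNormalizerPair (ind B hBo hBc (1 : K)) n' := by
  have hmem : ∀ g : G, g ∈ B ↔ inv g ∈ inv ⁻¹' B := fun g => by
    rw [Set.mem_preimage, inv_inv]
  have hbis : IsBisection (inv ⁻¹' B) := by
    constructor
    · intro g hg k hk e
      have := hB.2 hg hk (by rw [rng_inv, rng_inv, e])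
      rw [← inv_inv g, this, inv_inv]
    · intro g hg k hk e
      have := hB.1 hg hk (by rw [src_inv, src_inv, e])
      rw [← inv_inv g, this, inv_inv]
  have ho : IsOpen (inv ⁻¹' B) := hBo.preimage IsEtale.continuous_inv
  have hc : IsCompact (inv ⁻¹' B) := by
    have : inv ⁻¹' B = inv '' B := by
      ext g
      refine ⟨fun hg => ⟨inv g, hg, inv_inv g⟩, ?_⟩
      rintro ⟨b, hb, rfl⟩
      exact (hmem b).1 hb
    rw [this]
    exact hBc.image IsEtale.continuous_inv
  obtain ⟨h1, h2, h3⟩ := ind_mul_ind (K := K) hBo hBc ho hc hB fun _ => Iff.rfl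
  obtain ⟨k1, k2, k3⟩ := ind_mul_ind (K := K) ho hc hBo hBc hbis hmem
  exact ⟨ind (inv ⁻¹' B) ho hc 1, h2, k2, h1, k1, h3, k3⟩

end Bisection

variable (K G) in
/-- The semigroup of normalizers of the diagonal. -/
def normalizers : Subsemigroup (SteinbergAlgebra K G) where
  carrier := {n | ∃ n', IsNormalizerPair n n'}
  mul_mem' := by
    rintro n m ⟨n', hn⟩ ⟨m', hm⟩
    exact ⟨m' * n', hn.mul hm⟩

theorem isBisectionBasis_unitSupport (hK : IsIndecomposableRing K) (hG : HasMonomialUnits K G) :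
    IsBisectionBasis fun n : normalizers K G => unitSupport n.1 := by
  have := hK.1
  refine ⟨fun n => isOpen_unitSupport _, fun n => isCompact_unitSupport _, ?_, ?_, ?_⟩
  · rintro ⟨n, n', hn⟩
    exact hn.isBisection_unitSupport hK hG
  · intro B hB hBc hBb
    exact ⟨⟨_, exists_isNormalizerPair_ind hB hBc hBb⟩, unitSupport_ind hB hBc⟩
  · rintro ⟨n, n', hn⟩ ⟨m, m', hm⟩ k
    exact hn.mem_unitSupport_mul hK hG hm

/-! ### Transport along the diagonal-preserving isomorphism -/

section Map

variable {K' : Type*} [Ring K'] {G' : Type*} [TopologicalSpace G'] [ArrowGroupoid G']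
  [IsAmple G'] [T2Space G'] (φ : SteinbergAlgebra K G ≃* SteinbergAlgebra K' G')

theorem IsDiagIdem.map (hφ : ∀ a, φ a ∈ diagonal K' G' ↔ a ∈ diagonal K G)
    {e : SteinbergAlgebra K G} (he : IsDiagIdem e) : IsDiagIdem (φ e) where
  mem_diagonal := (hφ e).2 he.mem_diagonal
  mul_self := by rw [← map_mul, he.mul_self]
  comm d hd := by
    obtain ⟨d, rfl⟩ := φ.surjective d
    rw [← map_mul, ← map_mul, he.comm d ((hφ d).1 hd)]

theorem IsNormalizerPair.map (hφ : ∀ a, φ a ∈ diagonal K' G' ↔ a ∈ diagonal K G)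
    {n n' : SteinbergAlgebra K G} (hn : IsNormalizerPair n n') :
    IsNormalizerPair (φ n) (φ n') where
  mul_mul := by rw [← map_mul, ← map_mul, hn.mul_mul]
  mul_mul' := by rw [← map_mul, ← map_mul, hn.mul_mul']
  left := by rw [← map_mul]; exact hn.left.map φ hφ
  right := by rw [← map_mul]; exact hn.right.map φ hφ
  conj d hd := by
    obtain ⟨d, rfl⟩ := φ.surjective d
    rw [← map_mul, ← map_mul, hφ]
    exact hn.conj d ((hφ d).1 hd)
  conj' d hd := by
    obtain ⟨d, rfl⟩ := φ.surjective d
    rw [← map_mul, ← map_mul, hφ]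
    exact hn.conj' d ((hφ d).1 hd)

/-- A diagonal-preserving isomorphism restricts to the normalizers. -/
noncomputable def normalizersEquiv (hφ : ∀ a, φ a ∈ diagonal K' G' ↔ a ∈ diagonal K G) :
    normalizers K G ≃* normalizers K' G' where
  toFun n := ⟨φ n.1, n.2.elim fun n' hn => ⟨φ n', hn.map φ hφ⟩⟩
  invFun n := ⟨φ.symm n.1, n.2.elim fun n' hn => ⟨φ.symm n', hn.map φ.symm fun a => by
    rw [← hφ, φ.apply_symm_apply]⟩⟩
  left_inv n := Subtype.ext (φ.symm_apply_apply n.1)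
  right_inv n := Subtype.ext (φ.apply_symm_apply n.1)
  map_mul' n m := Subtype.ext (map_mul φ n.1 m.1)

theorem disjoint_unitSupport_map_iff (hK : IsIndecomposableRing K) (hK' : IsIndecomposableRing K')
    (hG : HasMonomialUnits K G) (hG' : HasMonomialUnits K' G')
    (hφ : ∀ a, φ a ∈ diagonal K' G' ↔ a ∈ diagonal K G) {n n' m m' : SteinbergAlgebra K G}
    (hn : IsNormalizerPair n n') (hm : IsNormalizerPair m m') :
    Disjoint (unitSupport n) (unitSupport m) ↔
      Disjoint (unitSupport (φ n)) (unitSupport (φ m)) := by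
  rw [← not_iff_not, hn.not_disjoint_iff hK hG hm,
    (hn.map φ hφ).not_disjoint_iff hK' hG' (hm.map φ hφ)]
  constructor
  · rintro ⟨c, hc, d, hd, h1, b, h2⟩
    refine ⟨φ c, (hφ c).2 hc, φ d, (hφ d).2 hd, ?_, φ b, ?_⟩
    · rw [← map_mul, ← map_mul, h1]
    · rw [← map_mul, ← map_mul]
      exact fun h => h2 (φ.injective h)
  · rintro ⟨c, hc, d, hd, h1, b, h2⟩
    obtain ⟨c, rfl⟩ := φ.surjective c
    obtain ⟨d, rfl⟩ := φ.surjective d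
    obtain ⟨b, rfl⟩ := φ.surjective b
    refine ⟨c, (hφ c).1 hc, d, (hφ d).1 hd, ?_, b, ?_⟩
    · rw [← map_mul, ← map_mul] at h1
      exact φ.injective h1
    · rw [← map_mul, ← map_mul] at h2
      exact fun h => h2 (congrArg φ h)

end Map

end SteinbergAlgebra

end ArrowGroupoid

theorem mainTheorem9 {G : Type*} {G' : Type*} {K : Type*} {K' : Type*}
    [TopologicalSpace G] [ArrowGroupoid G] [ArrowGroupoid.IsAmple G] [T2Space G]
    [TopologicalSpace G'] [ArrowGroupoid G'] [ArrowGroupoid.IsAmple G'] [T2Space G']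
    [Ring K] [Ring K'] (hK : IsIndecomposableRing K) (hK' : IsIndecomposableRing K')
    (hG : ArrowGroupoid.IsotropyCondition K G) (hG' : ArrowGroupoid.IsotropyCondition K' G')
    (φ : ArrowGroupoid.SteinbergAlgebra K G ≃* ArrowGroupoid.SteinbergAlgebra K' G')
    (hφ : φ '' ArrowGroupoid.diagonal K G = ArrowGroupoid.diagonal K' G') :
    Nonempty (ArrowGroupoid.TopIso G G') := by
  have hφ' : ∀ a, φ a ∈ ArrowGroupoid.diagonal K' G' ↔ a ∈ ArrowGroupoid.diagonal K G := by
    intro a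
    rw [← hφ, φ.injective.mem_set_image]
  have h := hG.hasMonomialUnits hK
  have h' := hG'.hasMonomialUnits hK'
  refine (ArrowGroupoid.SteinbergAlgebra.isBisectionBasis_unitSupport hK h).nonempty_topIso
    (ArrowGroupoid.SteinbergAlgebra.isBisectionBasis_unitSupport hK' h')
    (ArrowGroupoid.SteinbergAlgebra.normalizersEquiv φ hφ') ?_
  rintro ⟨n, n', hn⟩ ⟨m, m', hm⟩
  exact ArrowGroupoid.SteinbergAlgebra.disjoint_unitSupport_map_iff φ hK hK' h h' hφ' hn hm
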